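/- Let $\varepsilon>0$. Let $\mathbf C=(\mathbf C_1,\mathbf C_2):\mathbb R^2\to\mathbb R^2$ be a bounded, uniformly continuous $C^1$ map whose partial derivatives $\partial_{x_1}\mathbf C,\partial_{x_2}\mathbf C$ are bounded and uniformly continuous, and let $\chi:\mathbb R^2\to\mathbb R$ be bounded and uniformly continuous. Let $\{T(t)\}_{t\ge 0}$ be the heat semigroup on $L^1(\mathbb R^2)$ (real-valued functions): $T(0)=I$ and, for $t>0$, $$T(t)u(x)=\int_{\mathbb R^2}\frac{1}{4\pi\varepsilon^2t}\,e^{-|x-z|^2/(4\varepsilon^2t)}\,u(z)\,dz .$$ Let $A$ be its infinitesimal generator (the realization of $\varepsilon^2\Delta$ in $L^1(\mathbb R^2)$), that is, $Au=\lim_{t\searrow0}\frac{T(t)u-u}{t}$ in $L^1(\mathbb R^2)$, with domain $D(A)$ the set of all $u\in L^1(\mathbb R^2)$ for which this limit exists. Then $D(A)\subset W^{1,1}(\mathbb R^2)$, so that $$\mathcal A u:=Au-\mathbf C_1\,\partial_{x_1}u-\mathbf C_2\,\partial_{x_2}u+\chi u\in L^1(\mathbb R^2)\qquad(u\in D(A)),$$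 with weak partial derivatives, is well defined on $D(A)$. For $v_0\in L^1(\mathbb R^2)$, a mild solution of $$\partial_t v=\varepsilon^2\Delta v-\mathbf C(x)\cdot\nabla v+\chi(x)v,\qquad v(0,\cdot)=v_0,$$ is a continuous map $v:[0,\infty)\to L^1(\mathbb R^2)$ such that, for all $t\ge0$, $\int_0^t v(s)\,ds\in D(A)$ and $$v(t)=v_0+\mathcal A\int_0^t v(s)\,ds .$$ Then for every $v_0\in L^1(\mathbb R^2)$ with $v_0\ge0$ a.e. this equation has exactly one mild solution $v$, and this solution satisfies $v(t)\ge 0$ a.e. on $\mathbb R^2$ for all $t\ge0$. -/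

import Mathlib

open MeasureTheory Filter Topology Set
open scoped ContDiff

noncomputable section

namespace ConvDiff

/-- The plane `ℝ²` with its Euclidean norm and Lebesgue measure. -/
abbrev Plane : Type := EuclideanSpace ℝ (Fin 2)

/-- The Banach lattice `L¹(ℝ²)` of real integrable functions modulo a.e. equality. -/
abbrev L1 : Type := Plane →₁[volume] ℝ

/-- The `i`-th vector of the standard basis of `ℝ²`. -/
def e (i : Fin 2) : Plane := EuclideanSpace.single i 1

/-- The heat kernel `K(t,x) = (4πε²t)⁻¹ exp(-|x|²/(4ε²t))` on `ℝ²`. -/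
def heatKernel (ε t : ℝ) (x : Plane) : ℝ :=
  1 / (4 * Real.pi * ε ^ 2 * t) * Real.exp (-‖x‖ ^ 2 / (4 * ε ^ 2 * t))

theorem integrable_heatKernel (ε : ℝ) {t : ℝ} (ht : 0 < t) :
    Integrable (heatKernel ε t) volume := by
  unfold heatKernel
  by_cases hε : ε = 0
  · simp [hε]
  · have hb : 0 < 1 / (4 * ε ^ 2 * t) := by positivity
    have h := (GaussianFourier.integrable_cexp_neg_mul_sq_norm_add
      (b := ((1 / (4 * ε ^ 2 * t) : ℝ) : ℂ)) (by rw [Complex.ofReal_re]; exact hb) 0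
      (0 : Plane)).norm
    refine (h.congr (Eventually.of_forall fun x => ?_)).const_mul _
    simp only [zero_mul, add_zero, Complex.norm_exp]
    congr 1
    rw [← Complex.ofReal_neg, ← Complex.ofReal_pow, ← Complex.ofReal_mul, Complex.ofReal_re]
    ring

/-- The function `x ↦ ∫ K(t,x-z) u(z) dz`. -/
def heatConv (ε t : ℝ) (u : Plane → ℝ) (x : Plane) : ℝ :=
  ∫ z, heatKernel ε t (x - z) * u z

theorem integrable_heatConv (ε : ℝ) {t : ℝ} (ht : 0 < t) (u : L1) :
    Integrable (heatConv ε t u) volume := by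
  have h := Integrable.integrable_convolution (ContinuousLinearMap.mul ℝ ℝ)
    (L1.integrable_coeFn u) (integrable_heatKernel ε ht)
  refine h.congr (Eventually.of_forall fun x => ?_)
  simp only [convolution, heatConv, ContinuousLinearMap.mul_apply']
  exact integral_congr_ae (Eventually.of_forall fun z => mul_comm _ _)

/-- The heat semigroup on `L¹(ℝ²)`: convolution with `K(t,·)` for `t > 0`,
and the identity for `t = 0`. -/
def heatSemigroup (ε t : ℝ) (u : L1) : L1 :=
  if ht : 0 < t then (integrable_heatConv ε ht u).toL1 (heatConv ε t u) else u

/-- The graph of the infinitesimal generator `A` (the realization of `ε²Δ` in `L¹(ℝ²)`):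
`u ∈ D(A)` and `A u = a`, i.e. `(T(t)u - u)/t → a` in `L¹(ℝ²)` as `t ↘ 0`. -/
def IsHeatGenerator (ε : ℝ) (u a : L1) : Prop :=
  Tendsto (fun t : ℝ => t⁻¹ • (heatSemigroup ε t u - u)) (𝓝[>] 0) (𝓝 a)

/-- The domain `D(A)` of the generator of the heat semigroup. -/
def heatDomain (ε : ℝ) : Set L1 := {u | ∃ a, IsHeatGenerator ε u a}

/-- `g` is the weak partial derivative `∂_{x_i} u`. -/
def IsWeakPartial (i : Fin 2) (u g : L1) : Prop :=
  ∀ φ : Plane → ℝ, ContDiff ℝ ∞ φ → HasCompactSupport φ →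
    ∫ x, u x * fderiv ℝ φ x (e i) = -∫ x, g x * φ x

/-- The Sobolev space `W^{1,1}(ℝ²)`. -/
def W11 : Set L1 := {u | ∀ i, ∃ g, IsWeakPartial i u g}

/-- A bounded, uniformly continuous `C¹` velocity field whose first order partial derivatives
are bounded and uniformly continuous. -/
structure IsAdmissibleField (C : Plane → Plane) : Prop where
  bounded : ∃ M : ℝ, ∀ x, ‖C x‖ ≤ M
  uniformContinuous : UniformContinuous C
  contDiff : ContDiff ℝ 1 C
  bounded_partial : ∀ i, ∃ M : ℝ, ∀ x, ‖fderiv ℝ C x (e i)‖ ≤ M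
  uniformContinuous_partial : ∀ i, UniformContinuous fun x => fderiv ℝ C x (e i)

/-- `u ∈ D(A) ∩ W^{1,1}(ℝ²)` and `f = A u - C₁ ∂₁u - C₂ ∂₂u + χ u`. -/
def IsOperatorValue (ε : ℝ) (C : Plane → Plane) (χ : Plane → ℝ) (u f : L1) : Prop :=
  ∃ (a : L1) (g : Fin 2 → L1), IsHeatGenerator ε u a ∧ (∀ i, IsWeakPartial i u (g i)) ∧
    ∀ᵐ x, f x = a x - C x 0 * g 0 x - C x 1 * g 1 x + χ x * u x

/-- `v` (only its values on `[0,∞)` matter) is a mild solution of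
`∂ₜ v = ε²Δv - C·∇v + χ v`, `v(0) = v₀`: it is continuous from `[0,∞)` to `L¹(ℝ²)` and, for all
`t ≥ 0`, `∫₀ᵗ v(s) ds` lies in the domain of the operator `A - C·∇ + χ` and
`v(t) = v₀ + (A - C·∇ + χ) ∫₀ᵗ v(s) ds`. -/
def IsMildSolution (ε : ℝ) (C : Plane → Plane) (χ : Plane → ℝ) (v₀ : L1) (v : ℝ → L1) : Prop :=
  ContinuousOn v (Ici 0) ∧
    ∀ t, 0 ≤ t → ∃ f : L1, IsOperatorValue ε C χ (∫ s in (0 : ℝ)..t, v s) f ∧ v t = v₀ + f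

end ConvDiff

end

/-! The operator `𝒜 = A - C·∇ + χ` satisfies the Hille–Yosida conditions on `L¹(ℝ²)` with positive
resolvents: with `L` a Lipschitz constant of `C`, `|χ| ≤ m` and `β = 4L + m`, for all large `l` the
operator `l - 𝒜` is bijective onto `L¹`, its inverse is positive, and `(l - β)‖(l - 𝒜)⁻¹‖ ≤ 1`. The
Yosida approximations then converge to the solution (`exists_mild`), uniqueness follows from a
Duhamel argument (`mild_unique`), and positivity passes to the limit because the Yosida semigroups
are power series with nonnegative coefficients in positive operators (`yosidaExp_mem`).

Bijectivity is a perturbation argument. The resolvent of `A` is convolution with the Laplace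
transform `resK` of the heat kernel. Since `‖∂ᵢK_t‖₁ ≤ 3/(ε√t)` is integrable near `0`, this
resolvent maps into `W^{1,1}`, which gives `D(A) ⊂ W^{1,1}`, and its gradient kernel has norm
`O(l^{-1/2})`. Hence `P = (χ - C·∇)(l - A)⁻¹` has norm below `1` for large `l`, and `(l - 𝒜)⁻¹ = (l
- A)⁻¹(1 - P)⁻¹` (`isOperatorValue_iff_fullRes`).

The resolvent bound and positivity come from a splitting (`IsContractivityGauge.dissipative`). The
heat semigroup `T(h)` is a positive contraction, and on `W^{1,1}` the term `-C·∇u` is the derivative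
at `h = 0` of the positive operators `S_h u = u(x - hC(x))`, which satisfy `‖S_h‖ ≤ 1 + 4hL`. So `lu
- 𝒜u = f` expresses a multiple of `u` through `T(h)u`, `S_h u` and `f`, up to an error `o(h)`. A
sublinear functional compatible with positive operators can be applied to this identity: `‖u‖`
yields the norm bound, `‖u⁻‖` yields positivity of the resolvent. -/

noncomputable section

set_option linter.unusedSectionVars false

namespace ConvDiff

/-! ### Hille–Yosida theory: Yosida approximation, existence and uniqueness of mild solutions. -/

section Yosida

variable {X : Type*} [NormedAddCommGroup X] [NormedSpace ℝ X]

theorem norm_pow_apply_le {B : X →L[ℝ] X} {b : ℝ} (hb : 0 ≤ b) (hB : ∀ x, ‖B x‖ ≤ b * ‖x‖)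
    (k : ℕ) (x : X) : ‖(B ^ k) x‖ ≤ b ^ k * ‖x‖ := by
  induction k with
  | zero => simp
  | succ k ih =>
    rw [pow_succ', mul_apply_eq_comp]
    calc ‖B ((B ^ k) x)‖ ≤ b * ‖(B ^ k) x‖ := hB _
      _ ≤ b * (b ^ k * ‖x‖) := by gcongr
      _ = b ^ (k + 1) * ‖x‖ := by ring

variable [CompleteSpace X]

theorem hasSum_exp_apply (B : X →L[ℝ] X) (x : X) :
    HasSum (fun k : ℕ => ((k.factorial : ℝ))⁻¹ • (B ^ k) x) (NormedSpace.exp B x) :=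
  (NormedSpace.exp_series_hasSum_exp' (𝕂 := ℝ) B).mapL (ContinuousLinearMap.apply ℝ X x)

theorem norm_exp_apply_le {B : X →L[ℝ] X} {b : ℝ} (hb : 0 ≤ b) (hB : ∀ x, ‖B x‖ ≤ b * ‖x‖)
    (x : X) : ‖NormedSpace.exp B x‖ ≤ Real.exp b * ‖x‖ := by
  have h2 : HasSum (fun k : ℕ => ((k.factorial : ℝ))⁻¹ • b ^ k * ‖x‖) (Real.exp b * ‖x‖) := by
    rw [Real.exp_eq_exp_ℝ]
    exact (NormedSpace.exp_series_hasSum_exp' (𝕂 := ℝ) b).mul_right _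
  refine (hasSum_exp_apply B x).norm_le_of_bounded h2 fun k => ?_
  rw [norm_smul, Real.norm_of_nonneg (by positivity), smul_eq_mul, mul_assoc]
  gcongr
  exact norm_pow_apply_le hb hB k x

/-- `R` consists of the resolvents `(l - 𝒜)⁻¹`, `l ≥ l₀`, of a linear operator `𝒜` with graph `Op`,
which satisfies `‖(l - 𝒜)⁻¹‖ ≤ (l - β)⁻¹` and is densely defined. -/
structure IsResolventFamily (Op : X → X → Prop) (R : ℝ → X →L[ℝ] X) (β l₀ : ℝ) : Prop where
  op_iff : ∀ l, l₀ ≤ l → ∀ u f, Op u f ↔ u = R l (l • u - f)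
  norm_le : ∀ l, l₀ ≤ l → ∀ x, (l - β) * ‖R l x‖ ≤ ‖x‖
  denseRange : DenseRange (R l₀)
  omega_nonneg : 0 ≤ β
  pos : 0 < l₀
  two_mul_le : 2 * β ≤ l₀

/-- The Yosida approximation `l² (l - 𝒜)⁻¹ - l`. -/
def yosida (R : ℝ → X →L[ℝ] X) (l : ℝ) : X →L[ℝ] X :=
  l ^ 2 • R l - l • ContinuousLinearMap.id ℝ X

/-- The semigroup generated by the Yosida approximation. -/
def yosidaExp (R : ℝ → X →L[ℝ] X) (l t : ℝ) : X →L[ℝ] X :=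
  Real.exp (-l * t) • NormedSpace.exp (t • (l ^ 2 • R l))

theorem yosidaExp_zero (R : ℝ → X →L[ℝ] X) (l : ℝ) : yosidaExp R l 0 = 1 := by
  simp [yosidaExp, NormedSpace.exp_zero]

theorem hasDerivAt_yosidaExp (R : ℝ → X →L[ℝ] X) (l t : ℝ) :
    HasDerivAt (yosidaExp R l) (yosida R l * yosidaExp R l t) t := by
  have h1 : HasDerivAt (fun t : ℝ => Real.exp (-l * t)) (Real.exp (-l * t) * (-l)) t := by
    simpa using ((hasDerivAt_id t).const_mul (-l)).exp
  have h2 := hasDerivAt_exp_smul_const' (𝕂 := ℝ) (l ^ 2 • R l) t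
  refine (h1.smul h2).congr_deriv ?_
  ext x
  simp only [yosida, yosidaExp, add_apply, smul_apply,
    mul_apply_eq_comp, sub_apply, ContinuousLinearMap.id_apply,
    map_smul]
  module

theorem continuous_yosidaExp (R : ℝ → X →L[ℝ] X) (l : ℝ) : Continuous (yosidaExp R l) :=
  continuous_iff_continuousAt.2 fun t => (hasDerivAt_yosidaExp R l t).continuousAt

/-- For `t ≥ 0` the exponential series of `t l² R l` has nonnegative coefficients, so a closed
convex cone preserved by `R l` is preserved by its sum. The negative part `-l` of the Yosida
approximation enters only through the positive scalar `e^{-lt}`. Applied to the cone of nonnegative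
functions. -/
theorem yosidaExp_mem {R : ℝ → X →L[ℝ] X} {P : Set X} (hP : IsClosed P)
    (h0 : (0 : X) ∈ P) (hadd : ∀ x ∈ P, ∀ y ∈ P, x + y ∈ P)
    (hsmul : ∀ r : ℝ, 0 ≤ r → ∀ x ∈ P, r • x ∈ P) {l : ℝ} (hR : ∀ x ∈ P, R l x ∈ P)
    {t : ℝ} (ht : 0 ≤ t) {x : X} (hx : x ∈ P) : yosidaExp R l t x ∈ P := by
  refine hsmul _ (Real.exp_pos _).le _ ?_
  have hk : ∀ k : ℕ, ((t • (l ^ 2 • R l)) ^ k) x ∈ P := by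
    intro k
    induction k with
    | zero => simpa using hx
    | succ k ih =>
      rw [pow_succ', mul_apply_eq_comp]
      exact hsmul _ ht _ (hsmul _ (sq_nonneg l) _ (hR _ ih))
  refine hP.mem_of_tendsto (hasSum_exp_apply (t • (l ^ 2 • R l)) x)
    (Eventually.of_forall fun s => ?_)
  classical
  induction s using Finset.induction_on with
  | empty => simpa using h0
  | insert a s ha ih =>
    rw [Finset.sum_insert ha]
    exact hadd _ (hsmul _ (by positivity) _ (hk a)) _ ih

namespace IsResolventFamily

variable {Op : X → X → Prop} {R : ℝ → X →L[ℝ] X} {β l₀ : ℝ}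

theorem norm_resolvent_le (h : IsResolventFamily Op R β l₀) {l : ℝ} (hl : l₀ ≤ l) (x : X) :
    ‖l • R l x‖ ≤ 2 * ‖x‖ := by
  have h1 := h.norm_le l hl x
  have h2 := h.two_mul_le
  have h3 := h.pos
  have h4 := norm_nonneg (R l x)
  rw [norm_smul, Real.norm_of_nonneg (by linarith)]
  nlinarith

theorem op_resolvent (h : IsResolventFamily Op R β l₀) {l : ℝ} (hl : l₀ ≤ l) (y : X) :
    Op (R l y) (l • R l y - y) := by
  rw [h.op_iff l hl]
  simp

theorem op_sub (h : IsResolventFamily Op R β l₀) {u f u' f' : X} (h1 : Op u f) (h2 : Op u' f') :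
    Op (u - u') (f - f') := by
  rw [h.op_iff l₀ le_rfl] at *
  rw [smul_sub, sub_sub_sub_comm, map_sub, ← h1, ← h2]

theorem resolvent_identity (h : IsResolventFamily Op R β l₀) {l m : ℝ} (hl : l₀ ≤ l) (hm : l₀ ≤ m)
    (y : X) : R m y = R l y + (l - m) • R l (R m y) := by
  have h1 := (h.op_iff l hl _ _).1 (h.op_resolvent hm y)
  conv_lhs => rw [h1]
  simp only [map_sub, map_smul]
  module

theorem resolvent_comm (h : IsResolventFamily Op R β l₀) {l m : ℝ} (hl : l₀ ≤ l) (hm : l₀ ≤ m) :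
    Commute (R l) (R m) := by
  rcases eq_or_ne l m with rfl | hne
  · exact Commute.refl _
  · ext y
    have h1 := h.resolvent_identity hl hm y
    have h2 := h.resolvent_identity hm hl y
    have h3 : (l - m) • (R l (R m y) - R m (R l y)) = 0 := by
      have : (l - m) • (R l (R m y) - R m (R l y))
          = (R l y + (l - m) • R l (R m y)) + (m - l) • R m (R l y) - R l y := by module
      rw [this, ← h1, ← h2, sub_self]
    rcases smul_eq_zero.1 h3 with h4 | h4
    · exact absurd (sub_eq_zero.1 h4) hne
    · exact sub_eq_zero.1 h4

theorem yosida_apply (h : IsResolventFamily Op R β l₀) {l : ℝ} (hl : l₀ ≤ l) {u f : X}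
    (hu : Op u f) : yosida R l u = l • R l f := by
  have h1 := (h.op_iff l hl _ _).1 hu
  rw [map_sub, map_smul] at h1
  have h2 : R l f = l • R l u - u := by
    rw [eq_sub_iff_add_eq, add_comm]
    exact eq_sub_iff_add_eq.1 h1
  rw [h2]
  simp only [yosida, sub_apply, smul_apply,
    ContinuousLinearMap.id_apply]
  module

/-- The Yosida approximation is `𝒜` applied to `l (l - 𝒜)⁻¹ w`. This places approximate solutions in
the graph of `𝒜`, where a limit can be taken. -/
theorem op_yosida (h : IsResolventFamily Op R β l₀) {l : ℝ} (hl : l₀ ≤ l) (w : X) :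
    Op (l • R l w) (yosida R l w) := by
  rw [h.op_iff l hl]
  rw [← map_smul]
  congr 1
  simp only [yosida, sub_apply, smul_apply,
    ContinuousLinearMap.id_apply, map_smul]
  module

/-- On the domain, `n R n z - z = R n (𝒜 z)` is `O(1/n)`; density of the domain and the uniform
bound `‖n R n‖ ≤ 2` extend the convergence to every `x`. -/
theorem tendsto_resolvent (h : IsResolventFamily Op R β l₀) (x : X) :
    Tendsto (fun n : ℕ => (n : ℝ) • R n x) atTop (𝓝 x) := by
  rw [Metric.tendsto_atTop]
  intro η hη
  obtain ⟨y, hy⟩ := h.denseRange.exists_dist_lt x (ε := η / 6) (by positivity)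
  set z := R l₀ y
  set f := l₀ • z - y
  have hz : Op z f := h.op_resolvent le_rfl y
  -- Large enough for `n - β ≥ 2‖f‖/η`, which makes `‖R n f‖ ≤ η/2`; the summand `1` keeps `n - β ≥
  -- 1` in the case `f = 0`.
  obtain ⟨N, hN⟩ := exists_nat_ge (max l₀ (2 * (2 * ‖f‖ / η) + 2 * β + 1))
  refine ⟨N, fun n hn => ?_⟩
  have hnN : (N : ℝ) ≤ n := by exact_mod_cast hn
  have hl : l₀ ≤ (n : ℝ) := (le_max_left _ _).trans (hN.trans hnN)
  have hl2 : 2 * (2 * ‖f‖ / η) + 2 * β + 1 ≤ (n : ℝ) := (le_max_right _ _).trans (hN.trans hnN)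
  have h1 : (n : ℝ) • R n z - z = R n f := by
    have := (h.op_iff n hl _ _).1 hz
    rw [map_sub, map_smul] at this
    rw [sub_eq_iff_eq_add]
    exact (sub_eq_iff_eq_add'.1 this.symm)
  have h2 : ‖R n f‖ ≤ η / 2 := by
    have h3 := h.norm_le n hl f
    have h4 : 2 * ‖f‖ / η ≤ n - β := by
      have := h.omega_nonneg
      have : 0 ≤ 2 * ‖f‖ / η := by positivity
      linarith
    have h5 : 2 * ‖f‖ / η * ‖R n f‖ ≤ ‖f‖ :=
      (mul_le_mul_of_nonneg_right h4 (norm_nonneg _)).trans h3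
    rcases (norm_nonneg f).eq_or_lt with h6 | h6
    · have h8 : (1 : ℝ) ≤ n - β := by
        have := h.omega_nonneg
        have : 0 ≤ 2 * ‖f‖ / η := by positivity
        linarith
      rw [← h6] at h3
      nlinarith [norm_nonneg (R n f)]
    · have : ‖f‖ * (2 / η * ‖R n f‖) ≤ ‖f‖ * 1 := by
        calc _ = 2 * ‖f‖ / η * ‖R n f‖ := by ring
          _ ≤ _ := by linarith
      have := le_of_mul_le_mul_left this h6
      calc ‖R n f‖ = η / 2 * (2 / η * ‖R n f‖) := by field_simp
        _ ≤ η / 2 * 1 := by gcongr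
        _ = η / 2 := by ring
  rw [dist_eq_norm] at hy ⊢
  have h7 : (n : ℝ) • R n x - x = (n : ℝ) • R n (x - z) + R n f - (x - z) := by
    rw [← h1, map_sub]; module
  rw [h7]
  calc _ ≤ ‖(n : ℝ) • R n (x - z)‖ + ‖R n f‖ + ‖x - z‖ :=
        (norm_sub_le _ _).trans (by gcongr; exact norm_add_le _ _)
    _ ≤ 2 * ‖x - z‖ + η / 2 + ‖x - z‖ := by
        gcongr
        exact h.norm_resolvent_le hl _
    _ < η := by linarith

theorem norm_yosidaExp_le (h : IsResolventFamily Op R β l₀) {l : ℝ} (hl : l₀ ≤ l) {t : ℝ}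
    (ht : 0 ≤ t) (x : X) : ‖yosidaExp R l t x‖ ≤ Real.exp (2 * β * t) * ‖x‖ := by
  have h1 := h.two_mul_le
  have h2 := h.pos
  have h5 := h.omega_nonneg
  have h3 : 0 < l - β := by linarith
  have hB : ∀ x, ‖(t • (l ^ 2 • R l)) x‖ ≤ (t * (l ^ 2 / (l - β))) * ‖x‖ := by
    intro x
    have h4 := h.norm_le l hl x
    rw [smul_apply, smul_apply, norm_smul, norm_smul,
      Real.norm_of_nonneg ht, Real.norm_of_nonneg (sq_nonneg l)]
    calc t * (l ^ 2 * ‖R l x‖) = t * (l ^ 2 / (l - β) * ((l - β) * ‖R l x‖)) := by field_simp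
      _ ≤ t * (l ^ 2 / (l - β) * ‖x‖) := by gcongr
      _ = _ := by ring
  rw [yosidaExp, smul_apply, norm_smul, Real.norm_of_nonneg (Real.exp_pos _).le]
  calc _ ≤ Real.exp (-l * t) * (Real.exp (t * (l ^ 2 / (l - β))) * ‖x‖) := by
        gcongr
        exact norm_exp_apply_le (by positivity) hB x
    _ = Real.exp (-l * t + t * (l ^ 2 / (l - β))) * ‖x‖ := by rw [Real.exp_add]; ring
    _ ≤ _ := by
        gcongr
        -- Equivalent to `β(l - 2β) ≥ 0`. The resulting growth rate `2β` is not sharp, but it is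
        -- independent of `l`.
        have : l ^ 2 / (l - β) ≤ l + 2 * β := by
          rw [div_le_iff₀ h3]; nlinarith
        nlinarith

theorem commute_yosidaExp (h : IsResolventFamily Op R β l₀) {l m : ℝ} (hl : l₀ ≤ l) (hm : l₀ ≤ m)
    (t : ℝ) : Commute (yosida R l) (yosidaExp R m t) := by
  refine Commute.smul_right (Commute.exp_right (Commute.smul_right ?_ t)) _
  exact ((((h.resolvent_comm hl hm).smul_left (l ^ 2)).smul_right (m ^ 2))).sub_left
    ((Commute.one_left _).smul_left l)

theorem hasDerivAt_yosidaExp_comp (h : IsResolventFamily Op R β l₀) {l : ℝ} (hl : l₀ ≤ l)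
    {W : ℝ → X} {W' : X} {t s : ℝ} (hW : HasDerivAt W W' s) :
    HasDerivAt (fun s => yosidaExp R l (t - s) (W s))
      (yosidaExp R l (t - s) (W' - yosida R l (W s))) s := by
  have h1 : HasDerivAt (fun s => yosidaExp R l (t - s))
      ((-1 : ℝ) • (yosida R l * yosidaExp R l (t - s))) s :=
    (hasDerivAt_yosidaExp R l (t - s)).scomp s ((hasDerivAt_id s).const_sub t)
  refine (h1.clm_apply hW).congr_deriv ?_
  rw [(h.commute_yosidaExp hl hl (t - s)).eq]
  simp only [smul_apply, mul_apply_eq_comp, map_sub]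
  module

/-- The path `s ↦ E_m(t - s) E_l(s) x` joins `E_m(t) x` to `E_l(t) x`. Since everything commutes,
its derivative is `E_m(t - s) E_l(s)` applied to the difference of the two Yosida approximations at
`x`. -/
theorem norm_yosidaExp_sub_le (h : IsResolventFamily Op R β l₀) {l m : ℝ} (hl : l₀ ≤ l)
    (hm : l₀ ≤ m) {t : ℝ} (ht : 0 ≤ t) (x : X) :
    ‖yosidaExp R l t x - yosidaExp R m t x‖
      ≤ Real.exp (2 * β * t) * ‖yosida R l x - yosida R m x‖ * t := by
  have hd : ∀ s, HasDerivAt (fun s => yosidaExp R m (t - s) (yosidaExp R l s x))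
      (yosidaExp R m (t - s) (yosidaExp R l s (yosida R l x - yosida R m x))) s := by
    intro s
    have h1 : HasDerivAt (fun s => yosidaExp R l s x) (yosida R l (yosidaExp R l s x)) s := by
      simpa using (hasDerivAt_yosidaExp R l s).clm_apply (hasDerivAt_const s x)
    refine (h.hasDerivAt_yosidaExp_comp hm (t := t) h1).congr_deriv ?_
    have h2 := congrArg (fun A => A x) (h.commute_yosidaExp hl hl s).eq
    have h3 := congrArg (fun A => A x) (h.commute_yosidaExp hm hl s).eq
    simp only [mul_apply_eq_comp] at h2 h3
    rw [h2, h3, ← map_sub]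
  have hb : ∀ s ∈ Ico 0 t,
      ‖yosidaExp R m (t - s) (yosidaExp R l s (yosida R l x - yosida R m x))‖
        ≤ Real.exp (2 * β * t) * ‖yosida R l x - yosida R m x‖ := by
    intro s hs
    calc _ ≤ Real.exp (2 * β * (t - s)) *
          (Real.exp (2 * β * s) * ‖yosida R l x - yosida R m x‖) := by
          refine (h.norm_yosidaExp_le hm (by linarith [hs.2]) _).trans ?_
          gcongr
          exact h.norm_yosidaExp_le hl hs.1 _
      _ = _ := by rw [← mul_assoc, ← Real.exp_add]; ring_nf
  have := norm_image_sub_le_of_norm_deriv_le_segment' (fun s _ => (hd s).hasDerivWithinAt) hb t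
    (right_mem_Icc.2 ht)
  simpa [yosidaExp_zero] using this

theorem tendsto_yosida (h : IsResolventFamily Op R β l₀) {u f : X} (hu : Op u f) :
    Tendsto (fun n : ℕ => yosida R n u) atTop (𝓝 f) := by
  refine (h.tendsto_resolvent f).congr' ?_
  filter_upwards [(tendsto_natCast_atTop_atTop (R := ℝ)).eventually_ge_atTop l₀] with n hn
  exact (h.yosida_apply hn hu).symm

/-- For `z` in the domain the vectors `yosida R n z` converge, so `norm_yosidaExp_sub_le` controls
the differences; a general `x` is approximated by such `z` using the uniform exponential bound. -/
theorem uniformCauchySeqOn_yosidaExp (h : IsResolventFamily Op R β l₀) (x : X) {T : ℝ}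
    (hT : 0 ≤ T) : UniformCauchySeqOn (fun (n : ℕ) t => yosidaExp R n t x) atTop (Icc 0 T) := by
  rw [Metric.uniformCauchySeqOn_iff]
  intro η hη
  have hβ := h.omega_nonneg
  set K := Real.exp (2 * β * T) with hK
  have hK0 : 0 < K := Real.exp_pos _
  obtain ⟨y, hy⟩ := h.denseRange.exists_dist_lt x (ε := η / (4 * K)) (by positivity)
  set z := R l₀ y
  have hc := (h.tendsto_yosida (h.op_resolvent le_rfl y)).cauchySeq
  obtain ⟨N, hN⟩ := Metric.cauchySeq_iff.1 hc (η / (2 * K * (T + 1))) (by positivity)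
  obtain ⟨M, hM⟩ := exists_nat_ge l₀
  refine ⟨max N M, fun m hm n hn t ht => ?_⟩
  have hml : l₀ ≤ (m : ℝ) := hM.trans (by exact_mod_cast (le_max_right N M).trans hm)
  have hnl : l₀ ≤ (n : ℝ) := hM.trans (by exact_mod_cast (le_max_right N M).trans hn)
  have hd := hN m ((le_max_left N M).trans hm) n ((le_max_left N M).trans hn)
  rw [dist_eq_norm] at hy hd ⊢
  have hKt : Real.exp (2 * β * t) ≤ K := Real.exp_le_exp.2 (by nlinarith [ht.2])
  have e1 : ∀ k : ℕ, l₀ ≤ (k : ℝ) → ‖yosidaExp R k t (x - z)‖ ≤ K * ‖x - z‖ := fun k hk =>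
    (h.norm_yosidaExp_le hk ht.1 _).trans (by gcongr)
  have e2 : ‖yosidaExp R m t z - yosidaExp R n t z‖ ≤ K * (η / (2 * K * (T + 1))) * T :=
    (h.norm_yosidaExp_sub_le hml hnl ht.1 z).trans (by gcongr; exacts [ht.1, ht.2])
  have e3 : yosidaExp R m t x - yosidaExp R n t x = yosidaExp R m t (x - z)
      - yosidaExp R n t (x - z) + (yosidaExp R m t z - yosidaExp R n t z) := by
    simp only [map_sub]; abel
  rw [e3]
  have e4 : K * ‖x - z‖ < η / 4 := by
    calc K * ‖x - z‖ < K * (η / (4 * K)) := by gcongr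
      _ = η / 4 := by field_simp
  have e5 : K * (η / (2 * K * (T + 1))) * T ≤ η / 2 := by
    have : K * (η / (2 * K * (T + 1))) * T = η / 2 * (T / (T + 1)) := by field_simp
    rw [this]
    have : T / (T + 1) ≤ 1 := (div_le_one (by positivity)).2 (by linarith)
    nlinarith
  calc _ ≤ ‖yosidaExp R m t (x - z)‖ + ‖yosidaExp R n t (x - z)‖
        + ‖yosidaExp R m t z - yosidaExp R n t z‖ :=
        (norm_add_le _ _).trans (by gcongr; exact norm_sub_le _ _)
    _ < η := by linarith [e1 m hml, e1 n hnl]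

/-- The semigroup generated by `𝒜`, as a limit of the Yosida approximations, gives mild solutions
of `v' = 𝒜 v`. -/
theorem exists_mild (h : IsResolventFamily Op R β l₀) (x : X) :
    ∃ v : ℝ → X, ContinuousOn v (Ici 0) ∧
      (∀ t, 0 ≤ t → Op (∫ s in (0 : ℝ)..t, v s) (v t - x)) ∧
      ∀ t, 0 ≤ t → Tendsto (fun n : ℕ => yosidaExp R n t x) atTop (𝓝 (v t)) := by
  have hex : ∀ t, ∃ y, 0 ≤ t → Tendsto (fun n : ℕ => yosidaExp R n t x) atTop (𝓝 y) := by
    intro t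
    by_cases ht : 0 ≤ t
    · obtain ⟨y, hy⟩ := cauchySeq_tendsto_of_complete
        ((h.uniformCauchySeqOn_yosidaExp x ht).cauchySeq (right_mem_Icc.2 ht))
      exact ⟨y, fun _ => hy⟩
    · exact ⟨0, fun h => absurd h ht⟩
  choose v hv using hex
  have hun : ∀ T, 0 ≤ T →
      TendstoUniformlyOn (fun (n : ℕ) t => yosidaExp R n t x) v atTop (Icc 0 T) := fun T hT =>
    (h.uniformCauchySeqOn_yosidaExp x hT).tendstoUniformlyOn_of_tendsto fun t ht => hv t ht.1
  have hcE : ∀ n : ℕ, Continuous fun t => yosidaExp R n t x := fun n =>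
    (continuous_yosidaExp R n).clm_apply continuous_const
  have hcont : ∀ T, 0 ≤ T → ContinuousOn v (Icc 0 T) := fun T hT =>
    (hun T hT).continuousOn (Frequently.of_forall fun n => (hcE n).continuousOn)
  refine ⟨v, fun t ht => ?_, fun t ht => ?_, hv⟩
  · have ht' : (0 : ℝ) ≤ t := ht
    have h1 := hcont (t + 1) (by linarith) t ⟨ht', by linarith⟩
    refine h1.mono_of_mem_nhdsWithin ?_
    rw [← Ici_inter_Iic]
    exact inter_mem_nhdsWithin _ (Iic_mem_nhds (by linarith))
  · have hI : Tendsto (fun n : ℕ => ∫ s in (0 : ℝ)..t, yosidaExp R n s x) atTop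
        (𝓝 (∫ s in (0 : ℝ)..t, v s)) := by
      refine intervalIntegral.tendsto_integral_filter_of_dominated_convergence
        (fun _ => Real.exp (2 * β * t) * ‖x‖)
        (Eventually.of_forall fun n => (hcE n).aestronglyMeasurable) ?_
        intervalIntegrable_const (Eventually.of_forall fun s hs => hv s ?_)
      · filter_upwards [(tendsto_natCast_atTop_atTop (R := ℝ)).eventually_ge_atTop l₀] with n hn
        refine Eventually.of_forall fun s hs => ?_
        rw [uIoc_of_le ht] at hs
        refine (h.norm_yosidaExp_le hn hs.1.le x).trans ?_
        have := h.omega_nonneg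
        gcongr
        exact hs.2
      · rw [uIoc_of_le ht] at hs
        exact hs.1.le
    -- The integrated form of the approximate equation `E_n' = 𝒜_n E_n`, `E_n(0) = 1`.
    have hft : ∀ n : ℕ, yosida R n (∫ s in (0 : ℝ)..t, yosidaExp R n s x)
        = yosidaExp R n t x - x := by
      intro n
      rw [← ContinuousLinearMap.intervalIntegral_comp_comm _ ((hcE n).intervalIntegrable _ _)]
      have := intervalIntegral.integral_eq_sub_of_hasDerivAt
        (f := fun s => yosidaExp R n s x) (f' := fun s => yosida R n (yosidaExp R n s x))
        (a := 0) (b := t) (fun s _ => by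
          simpa using (hasDerivAt_yosidaExp R n s).clm_apply (hasDerivAt_const s x))
        (((yosida R n).continuous.comp (hcE n)).intervalIntegrable _ _)
      simpa [yosidaExp_zero] using this
    have hJ : Tendsto (fun n : ℕ => (n : ℝ) • R n (∫ s in (0 : ℝ)..t, yosidaExp R n s x)) atTop
        (𝓝 (∫ s in (0 : ℝ)..t, v s)) := by
      have h1 := h.tendsto_resolvent (∫ s in (0 : ℝ)..t, v s)
      have h2 : Tendsto (fun n : ℕ => (n : ℝ) • R n
          ((∫ s in (0 : ℝ)..t, yosidaExp R n s x) - ∫ s in (0 : ℝ)..t, v s)) atTop (𝓝 0) := by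
        refine squeeze_zero_norm' (a := fun n : ℕ =>
          2 * ‖(∫ s in (0 : ℝ)..t, yosidaExp R n s x) - ∫ s in (0 : ℝ)..t, v s‖) ?_ ?_
        · filter_upwards [(tendsto_natCast_atTop_atTop (R := ℝ)).eventually_ge_atTop l₀] with n hn
          exact h.norm_resolvent_le hn _
        · simpa using ((tendsto_iff_norm_sub_tendsto_zero.1 hI).const_mul 2)
      refine (h2.add h1).congr' (Eventually.of_forall fun n => ?_) |>.trans (by simp)
      simp only [map_sub]; module
    rw [h.op_iff l₀ le_rfl]
    refine tendsto_nhds_unique hJ ?_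
    -- Closedness of the graph of `𝒜`: by `op_yosida` and `hft` the pair `(n R n ∫E_n x, E_n(t)x -
    -- x)` lies in the graph, a condition expressed through the continuous map `R l₀`, hence stable
    -- under limits.
    have hK : Tendsto (fun n : ℕ => R l₀ (l₀ • ((n : ℝ) • R n
        (∫ s in (0 : ℝ)..t, yosidaExp R n s x)) - (yosidaExp R n t x - x))) atTop
        (𝓝 (R l₀ (l₀ • (∫ s in (0 : ℝ)..t, v s) - (v t - x)))) :=
      ((R l₀).continuous.tendsto _).comp ((hJ.const_smul l₀).sub ((hv t ht).sub_const x))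
    refine hK.congr' ?_
    filter_upwards [(tendsto_natCast_atTop_atTop (R := ℝ)).eventually_ge_atTop l₀] with n hn
    have := (h.op_iff l₀ le_rfl _ _).1 (h.op_yosida hn (∫ s in (0 : ℝ)..t, yosidaExp R n s x))
    rw [hft] at this
    exact this.symm

/-- An integrated solution of `W' = 𝒜 W`, `W(0) = 0`, vanishes. -/
theorem integral_eq_zero (h : IsResolventFamily Op R β l₀) {w : ℝ → X}
    (hw : ContinuousOn w (Ici 0)) (hop : ∀ t, 0 ≤ t → Op (∫ s in (0 : ℝ)..t, w s) (w t))
    {t : ℝ} (ht : 0 ≤ t) : ∫ s in (0 : ℝ)..t, w s = 0 := by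
  set W : ℝ → X := fun t => ∫ s in (0 : ℝ)..t, w s with hWdef
  have hint : ∀ t, 0 ≤ t → IntervalIntegrable w volume 0 t := fun t ht =>
    (hw.mono (by rw [uIcc_of_le ht]; exact Icc_subset_Ici_self)).intervalIntegrable
  have hWd : ∀ s, 0 < s → HasDerivAt W (w s) s := fun s hs =>
    intervalIntegral.integral_hasDerivAt_right (hint s hs.le)
      (hw.mono Ioi_subset_Ici_self |>.stronglyMeasurableAtFilter isOpen_Ioi s hs)
      (hw.continuousAt (Ici_mem_nhds hs))
  have hWc : ContinuousOn W (Icc 0 t) := by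
    have := intervalIntegral.continuousOn_primitive_interval (μ := volume) (f := w) (a := 0) (b := t)
      (by rw [uIcc_of_le ht]
          exact (hw.mono fun s hs => hs.1).integrableOn_Icc)
    rwa [uIcc_of_le ht] at this
  -- Duhamel's formula for the Yosida semigroup: `s ↦ E_n(t - s) W(s)` runs from `0` to `W(t)`, with
  -- derivative `E_n(t - s)(w(s) - 𝒜_n W(s))`, and `𝒜_n W(s) = n R n w(s)`. Since `n R n → 1`, the
  -- integrand tends to `0`.
  have key : ∀ n : ℕ, l₀ ≤ (n : ℝ) →
      ∫ s in (0 : ℝ)..t, yosidaExp R n (t - s) (w s - (n : ℝ) • R n (w s)) = W t := by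
    intro n hn
    have hc1 : Continuous fun s => yosidaExp R n (t - s) :=
      (continuous_yosidaExp R n).comp (continuous_const.sub continuous_id)
    have := intervalIntegral.integral_eq_sub_of_hasDerivAt_of_le ht
      (f := fun s => yosidaExp R n (t - s) (W s))
      (f' := fun s => yosidaExp R n (t - s) (w s - (n : ℝ) • R n (w s)))
      (hc1.continuousOn.clm_apply hWc) (fun s hs => by
        rw [← h.yosida_apply hn (hop s hs.1.le)]
        exact h.hasDerivAt_yosidaExp_comp hn (hWd s hs.1))
      (ContinuousOn.intervalIntegrable (by
        rw [uIcc_of_le ht]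
        have hwt : ContinuousOn w (Icc 0 t) := hw.mono fun s hs => hs.1
        exact hc1.continuousOn.clm_apply (hwt.sub
          (((R n).continuous.comp_continuousOn hwt).const_smul _))))
    simpa [yosidaExp_zero, hWdef] using this
  have hlim : Tendsto (fun n : ℕ =>
      ∫ s in (0 : ℝ)..t, yosidaExp R n (t - s) (w s - (n : ℝ) • R n (w s))) atTop (𝓝 0) := by
    have hwt : ContinuousOn w (Icc 0 t) := hw.mono fun s hs => hs.1
    obtain ⟨K, hK⟩ := isCompact_Icc.exists_bound_of_continuousOn hwt
    have hβ := h.omega_nonneg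
    have hbd : ∀ n : ℕ, l₀ ≤ (n : ℝ) → ∀ s ∈ Ioc 0 t,
        ‖yosidaExp R n (t - s) (w s - (n : ℝ) • R n (w s))‖
          ≤ Real.exp (2 * β * t) * ‖w s - (n : ℝ) • R n (w s)‖ := fun n hn s hs => by
      refine (h.norm_yosidaExp_le hn (by linarith [hs.2]) _).trans ?_
      gcongr
      linarith [hs.1]
    have := intervalIntegral.tendsto_integral_filter_of_dominated_convergence
      (μ := volume) (a := 0) (b := t) (l := atTop)
      (F := fun (n : ℕ) s => yosidaExp R n (t - s) (w s - (n : ℝ) • R n (w s)))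
      (f := fun _ => (0 : X)) (fun _ => Real.exp (2 * β * t) * (K + 2 * K)) ?_ ?_
      intervalIntegrable_const ?_
    · simpa using this
    · refine Eventually.of_forall fun n => ContinuousOn.aestronglyMeasurable ?_ measurableSet_uIoc
      rw [uIoc_of_le ht]
      refine ContinuousOn.mono ?_ Ioc_subset_Icc_self
      exact ((continuous_yosidaExp R n).comp
        (continuous_const.sub continuous_id)).continuousOn.clm_apply (hwt.sub
          (((R n).continuous.comp_continuousOn hwt).const_smul _))
    · filter_upwards [(tendsto_natCast_atTop_atTop (R := ℝ)).eventually_ge_atTop l₀] with n hn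
      refine Eventually.of_forall fun s hs => ?_
      rw [uIoc_of_le ht] at hs
      refine (hbd n hn s hs).trans ?_
      have hKs := hK s ⟨hs.1.le, hs.2⟩
      gcongr
      refine (norm_sub_le _ _).trans (add_le_add hKs ((h.norm_resolvent_le hn _).trans ?_))
      gcongr
    · refine Eventually.of_forall fun s hs => ?_
      rw [uIoc_of_le ht] at hs
      refine squeeze_zero_norm' (a := fun n : ℕ =>
        Real.exp (2 * β * t) * ‖w s - (n : ℝ) • R n (w s)‖) ?_ ?_
      · filter_upwards [(tendsto_natCast_atTop_atTop (R := ℝ)).eventually_ge_atTop l₀] with n hn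
        exact hbd n hn s hs
      · have := ((h.tendsto_resolvent (w s)).const_sub (w s)).norm.const_mul
          (Real.exp (2 * β * t))
        simpa using this
  refine tendsto_nhds_unique (tendsto_const_nhds.congr' ?_) hlim
  filter_upwards [(tendsto_natCast_atTop_atTop (R := ℝ)).eventually_ge_atTop l₀] with n hn
  exact (key n hn).symm

/-- Uniqueness of mild solutions. -/
theorem mild_unique (h : IsResolventFamily Op R β l₀) {x : X} {v w : ℝ → X}
    (hv : ContinuousOn v (Ici 0)) (hw : ContinuousOn w (Ici 0))
    (hvop : ∀ t, 0 ≤ t → Op (∫ s in (0 : ℝ)..t, v s) (v t - x))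
    (hwop : ∀ t, 0 ≤ t → Op (∫ s in (0 : ℝ)..t, w s) (w t - x)) {t : ℝ} (ht : 0 ≤ t) :
    w t = v t := by
  have hint : ∀ {f : ℝ → X}, ContinuousOn f (Ici 0) → ∀ t, 0 ≤ t →
      IntervalIntegrable f volume 0 t := fun hf t ht =>
    (hf.mono (by rw [uIcc_of_le ht]; exact Icc_subset_Ici_self)).intervalIntegrable
  have hop : ∀ t, 0 ≤ t → Op (∫ s in (0 : ℝ)..t, (w s - v s)) (w t - v t) := by
    intro t ht
    rw [intervalIntegral.integral_sub (hint hw t ht) (hint hv t ht)]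
    simpa using h.op_sub (hwop t ht) (hvop t ht)
  have h1 := hop t ht
  rw [h.integral_eq_zero (w := fun s => w s - v s) (hw.sub hv) hop ht] at h1
  -- Now `Op 0 (w t - v t)`; the Yosida approximations vanish at `0` and converge to the value of
  -- the operator, so this value is `0`.
  have h3 := h.tendsto_yosida h1
  simp only [map_zero] at h3
  exact sub_eq_zero.1 (tendsto_nhds_unique h3 tendsto_const_nhds)

end IsResolventFamily

end Yosida

/-! ### Bounded operators on `L¹`: multiplication and composition. -/

section Operators

theorem norm_toL1 {f : Plane → ℝ} (hf : Integrable f) : ‖hf.toL1 f‖ = ∫ x, |f x| :=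
  L1.norm_of_fun_eq_integral_norm hf

theorem norm_sub_toL1 (u : L1) {f : Plane → ℝ} (hf : Integrable f volume) :
    ‖hf.toL1 f - u‖ = ∫ x, |f x - u x| := by
  rw [L1.norm_eq_integral_norm]
  refine integral_congr_ae ?_
  filter_upwards [Lp.coeFn_sub (hf.toL1 f) u, hf.coeFn_toL1] with x h1 h2
  rw [h1, Pi.sub_apply, h2, Real.norm_eq_abs]

theorem nonneg_toL1 {f : Plane → ℝ} (hf : Integrable f) (h : 0 ≤ᵐ[volume] f) : 0 ≤ hf.toL1 f := by
  rw [← Lp.coeFn_nonneg]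
  filter_upwards [hf.coeFn_toL1, h] with x h1 h2
  rwa [h1]

theorem coeFn_nonneg {u : L1} (h : 0 ≤ u) : ∀ᵐ x, 0 ≤ u x := (Lp.coeFn_nonneg u).2 h

section

variable {F : (Plane → ℝ) → Plane → ℝ} (hF : ∀ u : L1, Integrable (F u))
    (hcongr : ∀ f g : Plane → ℝ, f =ᵐ[volume] g → F f =ᵐ[volume] F g)
    (hadd : ∀ f g : Plane → ℝ, F (f + g) = F f + F g)
    (hsmul : ∀ (c : ℝ) (f : Plane → ℝ), F (c • f) = c • F f)
    {K : ℝ} (hK : ∀ u : L1, ∫ x, |F u x| ≤ K * ‖u‖)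

/-- The bounded operator on `L¹` given by a linear map of functions. -/
def l1Op : L1 →L[ℝ] L1 :=
  LinearMap.mkContinuous
    { toFun := fun u => (hF u).toL1 (F u)
      map_add' := fun u v => by
        rw [← Integrable.toL1_add, Integrable.toL1_eq_toL1_iff, ← hadd]
        exact hcongr _ _ (Lp.coeFn_add u v)
      map_smul' := fun c u => by
        rw [RingHom.id_apply, ← Integrable.toL1_smul, Integrable.toL1_eq_toL1_iff, ← Pi.smul_def,
          ← hsmul]
        exact hcongr _ _ (Lp.coeFn_smul c u) } K fun u => by
    change ‖(hF u).toL1 (F u)‖ ≤ _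
    rw [norm_toL1]
    exact hK u

theorem coeFn_l1Op (u : L1) : l1Op hF hcongr hadd hsmul hK u =ᵐ[volume] F u :=
  (hF u).coeFn_toL1

theorem norm_l1Op_le (u : L1) : ‖l1Op hF hcongr hadd hsmul hK u‖ ≤ K * ‖u‖ := by
  change ‖(hF u).toL1 (F u)‖ ≤ _
  rw [norm_toL1]
  exact hK u

theorem l1Op_nonneg {u : L1} (hu : ∀ᵐ x, 0 ≤ F u x) : 0 ≤ l1Op hF hcongr hadd hsmul hK u :=
  nonneg_toL1 (hF u) hu

end

/-- Multiplication by a bounded continuous function. -/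
def mulL (ψ : Plane → ℝ) (hψ : Continuous ψ) (M : ℝ) (hM : ∀ x, |ψ x| ≤ M) : L1 →L[ℝ] L1 :=
  l1Op (F := fun f x => ψ x * f x)
    (fun u => (L1.integrable_coeFn u).bdd_mul hψ.aestronglyMeasurable (Eventually.of_forall hM))
    (fun f g h => h.mono fun x hx => by simp only [hx])
    (fun f g => by ext x; simp [mul_add]) (fun c f => by ext x; simp; ring) fun u => by
      rw [L1.norm_eq_integral_norm, ← integral_const_mul]
      refine integral_mono_of_nonneg (Eventually.of_forall fun x => abs_nonneg _)
        ((L1.integrable_coeFn u).norm.const_mul M) (Eventually.of_forall fun x => ?_)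
      simp only [abs_mul]
      exact mul_le_mul_of_nonneg_right (hM x) (abs_nonneg _)

theorem coeFn_mulL {ψ : Plane → ℝ} (hψ : Continuous ψ) {M : ℝ} (hM : ∀ x, |ψ x| ≤ M) (u : L1) :
    mulL ψ hψ M hM u =ᵐ[volume] fun x => ψ x * u x :=
  coeFn_l1Op _ _ _ _ _ u

theorem norm_mulL_le {ψ : Plane → ℝ} (hψ : Continuous ψ) {M : ℝ} (hM : ∀ x, |ψ x| ≤ M) (u : L1) :
    ‖mulL ψ hψ M hM u‖ ≤ M * ‖u‖ :=
  norm_l1Op_le _ _ _ _ _ u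

theorem mulL_nonneg {ψ : Plane → ℝ} (hψ : Continuous ψ) {M : ℝ} (hM : ∀ x, |ψ x| ≤ M)
    (h0 : ∀ x, 0 ≤ ψ x) {u : L1} (hu : 0 ≤ u) : 0 ≤ mulL ψ hψ M hM u :=
  l1Op_nonneg _ _ _ _ _ <| ((coeFn_nonneg hu).mono fun x hx => mul_nonneg (h0 x) hx)

/-- Integration against a bounded continuous function. -/
def testL (ψ : Plane → ℝ) (hψ : Continuous ψ) (M : ℝ) (hM : ∀ x, |ψ x| ≤ M) : L1 →L[ℝ] ℝ :=
  (L1.integralCLM (α := Plane) (E := ℝ) (μ := volume)).comp (mulL ψ hψ M hM)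

theorem testL_apply {ψ : Plane → ℝ} (hψ : Continuous ψ) {M : ℝ} (hM : ∀ x, |ψ x| ≤ M) (u : L1) :
    testL ψ hψ M hM u = ∫ x, u x * ψ x := by
  rw [testL, ContinuousLinearMap.comp_apply, ← L1.integral_eq, L1.integral_eq_integral]
  refine integral_congr_ae ((coeFn_mulL hψ hM u).mono fun x hx => ?_)
  simp only [hx, mul_comm]

/-- `Φ` is measurable and the push-forward of Lebesgue measure is at most `c` times Lebesgue
measure. -/
structure MapBound (Φ : Plane → Plane) (c : ℝ) : Prop where
  measurable : Measurable Φ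
  nonneg : 0 ≤ c
  map_le : Measure.map Φ volume ≤ ENNReal.ofReal c • volume

namespace MapBound

variable {Φ : Plane → Plane} {c : ℝ}

theorem quasi (h : MapBound Φ c) : Measure.QuasiMeasurePreserving Φ volume volume :=
  ⟨h.measurable, (Measure.absolutelyContinuous_of_le h.map_le).trans
    (Measure.smul_absolutelyContinuous)⟩

theorem integrable_comp (h : MapBound Φ c) {f : Plane → ℝ} (hf : Integrable f) :
    Integrable fun x => f (Φ x) := by
  have h1 : Integrable f (Measure.map Φ volume) :=
    (hf.smul_measure ENNReal.ofReal_ne_top).mono_measure h.map_le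
  exact h1.comp_measurable h.measurable

theorem integral_abs_comp_le (h : MapBound Φ c) {f : Plane → ℝ} (hf : Integrable f) :
    ∫ x, |f (Φ x)| ≤ c * ∫ x, |f x| := by
  have h1 : Integrable f (ENNReal.ofReal c • volume) := hf.smul_measure ENNReal.ofReal_ne_top
  have h2 : Integrable f (Measure.map Φ volume) := h1.mono_measure h.map_le
  calc ∫ x, |f (Φ x)| = ∫ x, |f x| ∂(Measure.map Φ volume) :=
        (integral_map h.measurable.aemeasurable h2.abs.aestronglyMeasurable).symm
    _ ≤ ∫ x, |f x| ∂(ENNReal.ofReal c • volume) :=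
        integral_mono_measure h.map_le (Eventually.of_forall fun x => abs_nonneg _) h1.abs
    _ = c * ∫ x, |f x| := by
        rw [integral_smul_measure, ENNReal.toReal_ofReal h.nonneg, smul_eq_mul]

/-- Composition with `Φ` as an operator on `L¹`. -/
def compL (h : MapBound Φ c) : L1 →L[ℝ] L1 :=
  l1Op (F := fun f x => f (Φ x)) (fun u => h.integrable_comp (L1.integrable_coeFn u))
    (fun _ _ hfg => h.quasi.ae_eq_comp hfg) (fun _ _ => rfl) (fun _ _ => rfl) fun u => by
      rw [L1.norm_eq_integral_norm]
      exact h.integral_abs_comp_le (L1.integrable_coeFn u)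

theorem coeFn_compL (h : MapBound Φ c) (u : L1) : h.compL u =ᵐ[volume] fun x => u (Φ x) :=
  coeFn_l1Op _ _ _ _ _ u

theorem norm_compL_le (h : MapBound Φ c) (u : L1) : ‖h.compL u‖ ≤ c * ‖u‖ :=
  norm_l1Op_le _ _ _ _ _ u

theorem compL_nonneg (h : MapBound Φ c) {u : L1} (hu : 0 ≤ u) : 0 ≤ h.compL u :=
  l1Op_nonneg _ _ _ _ _ <| (h.quasi.ae (coeFn_nonneg hu))

theorem mono (h : MapBound Φ c) {d : ℝ} (hcd : c ≤ d) : MapBound Φ d :=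
  ⟨h.measurable, h.nonneg.trans hcd, h.map_le.trans (by gcongr)⟩

end MapBound

theorem mapBound_sub (y : Plane) : MapBound (fun x => x - y) 1 := by
  refine ⟨by fun_prop, zero_le_one, ?_⟩
  rw [(measurePreserving_sub_right volume y).map_eq]
  simp

/-- Composition with maps close to the identity is close to the identity in `L¹`. -/
theorem exists_integral_comp_sub_le {u : Plane → ℝ} (hu : Integrable u) {η : ℝ} (hη : 0 < η) :
    ∃ δ > 0, ∀ Φ : Plane → Plane, MapBound Φ 2 → (∀ x, dist (Φ x) x ≤ δ) →
      ∫ x, |u (Φ x) - u x| ≤ η := by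
  obtain ⟨g, hgc, hgu, hg, hgi⟩ := hu.exists_hasCompactSupport_integral_sub_le
    (ε := η / 6) (by positivity)
  -- Displacements will be at most `1`, so both `g` and `g ∘ Φ` vanish outside this compact set,
  -- whatever `Φ` is.
  set S := Metric.cthickening 1 (tsupport g) with hS
  have hScomp : IsCompact S := hgc.isCompact.cthickening
  have hSfin : volume S ≠ ⊤ := hScomp.measure_ne_top
  set V := volume.real S with hV
  have hV0 : 0 ≤ V := measureReal_nonneg
  obtain ⟨δ, hδ, hgδ⟩ := Metric.uniformContinuous_iff.1
    (hgc.uniformContinuous_of_continuous hg) (η / (2 * (V + 1))) (by positivity)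
  refine ⟨min (δ / 2) 1, by positivity, fun Φ hΦ hΦδ => ?_⟩
  have hd := hu.sub hgi
  have e1 : ∫ x, |(u - g) (Φ x)| ≤ 2 * (η / 6) :=
    (hΦ.integral_abs_comp_le hd).trans (by gcongr; exact hgu)
  have e2 : ∀ x, |g (Φ x) - g x| ≤ S.indicator (fun _ => η / (2 * (V + 1))) x := by
    intro x
    by_cases hx : x ∈ S
    · rw [indicator_of_mem hx]
      have h1 : dist (Φ x) x < δ := (hΦδ x).trans_lt ((min_le_left _ _).trans_lt (by linarith))
      have h2 := hgδ h1
      rw [Real.dist_eq] at h2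
      exact h2.le
    · rw [indicator_of_notMem hx]
      have h1 : g x = 0 := image_eq_zero_of_notMem_tsupport fun h =>
        hx (Metric.self_subset_cthickening _ h)
      have h2 : g (Φ x) = 0 := image_eq_zero_of_notMem_tsupport fun h => hx
        (Metric.mem_cthickening_of_dist_le x (Φ x) 1 _ h
          (by rw [dist_comm]; exact (hΦδ x).trans (min_le_right _ _)))
      simp [h1, h2]
  have hind : Integrable (S.indicator fun _ : Plane => η / (2 * (V + 1))) :=
    (integrable_indicator_iff hScomp.measurableSet).2 (integrableOn_const hSfin)
  have e3 : ∫ x, |g (Φ x) - g x| ≤ η / 2 := by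
    refine (integral_mono_of_nonneg (Eventually.of_forall fun x => abs_nonneg _) hind
      (Eventually.of_forall e2)).trans ?_
    rw [integral_indicator hScomp.measurableSet, setIntegral_const, smul_eq_mul, ← hV]
    calc V * (η / (2 * (V + 1))) = η / 2 * (V / (V + 1)) := by field_simp
      _ ≤ η / 2 * 1 := by gcongr; exact (div_le_one (by positivity)).2 (by linarith)
      _ = η / 2 := mul_one _
  have i1 : Integrable fun x => |(u - g) (Φ x)| := (hΦ.integrable_comp hd).abs
  have i2 : Integrable fun x => |g (Φ x) - g x| := ((hΦ.integrable_comp hgi).sub hgi).abs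
  have i3 : Integrable fun x => |u x - g x| := hd.abs
  calc ∫ x, |u (Φ x) - u x| ≤ ∫ x, (|(u - g) (Φ x)| + |g (Φ x) - g x| + |u x - g x|) := by
        refine integral_mono_of_nonneg (Eventually.of_forall fun x => abs_nonneg _)
          ((i1.add i2).add i3) (Eventually.of_forall fun x => ?_)
        have : u (Φ x) - u x = (u - g) (Φ x) + (g (Φ x) - g x) - (u x - g x) := by
          simp only [Pi.sub_apply]; ring
        simp only [this]
        exact (abs_sub _ _).trans (by gcongr; exact abs_add_le _ _)
    _ = (∫ x, |(u - g) (Φ x)|) + (∫ x, |g (Φ x) - g x|) + ∫ x, |u x - g x| := by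
        have i12 : Integrable fun x => |(u - g) (Φ x)| + |g (Φ x) - g x| := i1.add i2
        rw [integral_add i12 i3, integral_add i1 i2]
    _ ≤ 2 * (η / 6) + η / 2 + η / 6 := by
        gcongr
        exact hgu
    _ = η := by ring

end Operators

/-! ### Convolution on `L¹` and approximate identities. -/

section Convolution

/-- The convolution `x ↦ ∫ f(z) k(x-z) dz`. -/
def convFn (k f : Plane → ℝ) : Plane → ℝ :=
  convolution f k (ContinuousLinearMap.mul ℝ ℝ) volume

theorem convFn_apply (k f : Plane → ℝ) (x : Plane) : convFn k f x = ∫ z, f z * k (x - z) := rfl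

theorem convFn_comm (k f : Plane → ℝ) : convFn k f = convFn f k := by
  unfold convFn
  rw [← convolution_flip]
  congr 1
  ext
  simp

theorem convFn_congr {k k' f f' : Plane → ℝ} (hk : k =ᵐ[volume] k') (hf : f =ᵐ[volume] f') :
    convFn k f = convFn k' f' :=
  convolution_congr _ hf hk

theorem integrable_convFn {k f : Plane → ℝ} (hk : Integrable k) (hf : Integrable f) :
    Integrable (convFn k f) :=
  hf.integrable_convolution _ hk

theorem integral_abs_convFn_le {k f : Plane → ℝ} (hk : Integrable k) (hf : Integrable f) :
    ∫ x, |convFn k f x| ≤ (∫ x, |k x|) * ∫ x, |f x| := by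
  have h1 := integral_convolution (μ := volume) (ν := volume) (ContinuousLinearMap.mul ℝ ℝ)
    hf.abs hk.abs
  have h2 : (∫ x, |k x|) * ∫ x, |f x| = ∫ x, convFn (fun x => |k x|) (fun x => |f x|) x := by
    rw [mul_comm]; exact h1.symm
  rw [h2]
  refine integral_mono_of_nonneg (Eventually.of_forall fun x => abs_nonneg _)
    (integrable_convFn hk.abs hf.abs) (Eventually.of_forall fun x => ?_)
  simp only [convFn_apply]
  rw [← Real.norm_eq_abs]
  refine (norm_integral_le_integral_norm _).trans (le_of_eq ?_)
  simp

theorem convFn_add_right_ae {k f g : Plane → ℝ} (hk : Integrable k) (hf : Integrable f)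
    (hg : Integrable g) : convFn k (f + g) =ᵐ[volume] convFn k f + convFn k g := by
  filter_upwards [hf.ae_convolution_exists (ContinuousLinearMap.mul ℝ ℝ) hk,
    hg.ae_convolution_exists (ContinuousLinearMap.mul ℝ ℝ) hk] with x h1 h2
  exact h1.add_distrib h2

theorem convFn_smul_right (k f : Plane → ℝ) (c : ℝ) : convFn k (c • f) = c • convFn k f :=
  smul_convolution

/-- Convolution as a bounded bilinear map on `L¹`. -/
def convB : L1 →L[ℝ] L1 →L[ℝ] L1 :=
  LinearMap.mkContinuous₂
    (LinearMap.mk₂ ℝ (fun k f : L1 =>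
        (integrable_convFn (L1.integrable_coeFn k) (L1.integrable_coeFn f)).toL1 (convFn k f))
      (fun k l f => by
        rw [← Integrable.toL1_add, Integrable.toL1_eq_toL1_iff,
          convFn_congr (Lp.coeFn_add k l) EventuallyEq.rfl, convFn_comm, convFn_comm k,
          convFn_comm l]
        exact convFn_add_right_ae (L1.integrable_coeFn f) (L1.integrable_coeFn k)
          (L1.integrable_coeFn l))
      (fun c k f => by
        rw [← Integrable.toL1_smul, Integrable.toL1_eq_toL1_iff,
          convFn_congr (Lp.coeFn_smul c k) EventuallyEq.rfl, convFn_comm, convFn_smul_right,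
          convFn_comm]
        rfl)
      (fun k f g => by
        rw [← Integrable.toL1_add, Integrable.toL1_eq_toL1_iff,
          convFn_congr EventuallyEq.rfl (Lp.coeFn_add f g)]
        exact convFn_add_right_ae (L1.integrable_coeFn k) (L1.integrable_coeFn f)
          (L1.integrable_coeFn g))
      (fun c k f => by
        rw [← Integrable.toL1_smul, Integrable.toL1_eq_toL1_iff,
          convFn_congr EventuallyEq.rfl (Lp.coeFn_smul c f), convFn_smul_right]
        rfl)) 1 fun k f => by
    rw [LinearMap.mk₂_apply, norm_toL1, one_mul, L1.norm_eq_integral_norm,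
      L1.norm_eq_integral_norm]
    exact integral_abs_convFn_le (L1.integrable_coeFn k) (L1.integrable_coeFn f)

theorem coeFn_convB (k f : L1) : convB k f =ᵐ[volume] convFn k f :=
  (integrable_convFn (L1.integrable_coeFn k) (L1.integrable_coeFn f)).coeFn_toL1

theorem norm_convB_le (k f : L1) : ‖convB k f‖ ≤ ‖k‖ * ‖f‖ := by
  have := convB.le_of_opNorm₂_le_of_le (LinearMap.mkContinuous₂_norm_le _ zero_le_one _)
    (le_refl ‖k‖) (le_refl ‖f‖)
  simpa using this

theorem coeFn_convB_toL1 {k : Plane → ℝ} (hk : Integrable k) (f : L1) :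
    convB (hk.toL1 k) f =ᵐ[volume] convFn k f := by
  rw [← convFn_congr hk.coeFn_toL1 (EventuallyEq.refl _ (f : Plane → ℝ))]
  exact coeFn_convB _ _

theorem convB_comm (k f : L1) : convB k f = convB f k := by
  apply Lp.ext
  filter_upwards [coeFn_convB k f, coeFn_convB f k] with x h1 h2
  rw [h1, h2, convFn_comm]

theorem convB_assoc (k l f : L1) : convB k (convB l f) = convB (convB k l) f := by
  apply Lp.ext
  have hk := L1.integrable_coeFn k
  have hl := L1.integrable_coeFn l
  have hf := L1.integrable_coeFn f
  filter_upwards [coeFn_convB k (convB l f), coeFn_convB (convB k l) f,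
    hf.norm.ae_convolution_exists (ContinuousLinearMap.mul ℝ ℝ)
      (hl.norm.integrable_convolution (ContinuousLinearMap.mul ℝ ℝ) hk.norm)] with x h1 h2 h3
  rw [h1, h2, convFn_congr EventuallyEq.rfl (coeFn_convB l f),
    convFn_congr (coeFn_convB k l) EventuallyEq.rfl]
  exact convolution_assoc (ContinuousLinearMap.mul ℝ ℝ) (ContinuousLinearMap.mul ℝ ℝ)
    (ContinuousLinearMap.mul ℝ ℝ) (ContinuousLinearMap.mul ℝ ℝ) (fun x y z => by simp [mul_assoc])
    hf.aestronglyMeasurable hl.aestronglyMeasurable hk.aestronglyMeasurable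
    (hf.ae_convolution_exists _ hl) (hl.norm.ae_convolution_exists _ hk.norm) h3

theorem convB_nonneg {k f : L1} (hk : 0 ≤ k) (hf : 0 ≤ f) : 0 ≤ convB k f := by
  refine nonneg_toL1 (integrable_convFn (L1.integrable_coeFn k) (L1.integrable_coeFn f))
    (Eventually.of_forall fun x => integral_nonneg_of_ae ?_)
  have h1 : ∀ᵐ z, 0 ≤ (k : Plane → ℝ) (x - z) :=
    (Measure.measurePreserving_sub_left volume x).quasiMeasurePreserving.ae (coeFn_nonneg hk)
  filter_upwards [h1, coeFn_nonneg hf] with z h2 h3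
  exact mul_nonneg h3 h2

/-- Convolution with a concentrated probability density is close to the identity in `L¹`. -/
theorem exists_norm_convB_sub_le (u : L1) {η : ℝ} (hη : 0 < η) :
    ∃ δ > 0, ∀ (k : Plane → ℝ) (hk : Integrable k), (∀ x, 0 ≤ k x) → ∫ x, k x = 1 →
      ∫ y in {y | δ < ‖y‖}, k y ≤ δ → ‖convB (hk.toL1 k) u - u‖ ≤ η := by
  have hu := L1.integrable_coeFn u
  obtain ⟨δ₀, hδ₀, hcomp⟩ := exists_integral_comp_sub_le hu (η := η / 2) (by positivity)
  -- Translations by at most `δ₀` cost at most `η/2`; longer ones cost at most `2‖u‖` each and carry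
  -- mass at most `δ`, so the second bound makes their share at most `η/2`.
  set δ := min δ₀ (η / (4 * (‖u‖ + 1))) with hδdef
  have hδpos : 0 < δ := by positivity
  refine ⟨δ, hδpos, fun k hk hk0 hk1 htail => ?_⟩
  have hmS : MeasurableSet {y : Plane | δ < ‖y‖} :=
    (isOpen_lt continuous_const continuous_norm).measurableSet
  set N : Plane → ℝ := fun y => ∫ x, |u (x - y) - u x| with hN
  have hN1 : ∀ y, ¬ δ < ‖y‖ → N y ≤ η / 2 := fun y hy =>
    hcomp _ ((mapBound_sub y).mono one_le_two) fun x => by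
      simpa [dist_eq_norm] using (not_lt.1 hy).trans (min_le_left _ _)
  have hN2 : ∀ y, N y ≤ 2 * ‖u‖ := fun y => by
    have h1 := (mapBound_sub y).integral_abs_comp_le hu
    have h2 := (mapBound_sub y).integrable_comp hu
    rw [one_mul] at h1
    calc N y ≤ ∫ x, (|u (x - y)| + |u x|) :=
          integral_mono_of_nonneg (Eventually.of_forall fun x => abs_nonneg _) (h2.abs.add hu.abs)
            (Eventually.of_forall fun x => abs_sub _ _)
      _ = (∫ x, |u (x - y)|) + ∫ x, |u x| := integral_add h2.abs hu.abs
      _ ≤ 2 * ‖u‖ := by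
          rw [L1.norm_eq_integral_norm]
          simp only [Real.norm_eq_abs]
          linarith
  have hF : Integrable (fun p : Plane × Plane => k p.2 * (u (p.1 - p.2) - u p.1))
      (volume.prod volume) := by
    have h1 := hk.convolution_integrand (ContinuousLinearMap.mul ℝ ℝ) hu
    have h2 := hu.mul_prod hk
    refine (h1.sub h2).congr (Eventually.of_forall fun p => ?_)
    simp only [Pi.sub_apply, ContinuousLinearMap.mul_apply']
    ring
  have hpt : ∀ᵐ x, (convB (hk.toL1 k) u - u : L1) x = ∫ y, k y * (u (x - y) - u x) := by
    filter_upwards [Lp.coeFn_sub (convB (hk.toL1 k) u) u, coeFn_convB_toL1 hk u,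
      hk.ae_convolution_exists (ContinuousLinearMap.mul ℝ ℝ) hu] with x h1 h2 h3
    have h3' : Integrable fun y => k y * u (x - y) := h3
    rw [h1, Pi.sub_apply, h2, convFn_comm, convFn_apply]
    simp only [mul_sub]
    rw [integral_sub h3' (hk.mul_const _), integral_mul_const, hk1, one_mul]
  have hkN : ∫ x, |(convB (hk.toL1 k) u - u : L1) x| ≤ ∫ y, k y * N y := by
    calc ∫ x, |(convB (hk.toL1 k) u - u : L1) x|
        = ∫ x, |∫ y, k y * (u (x - y) - u x)| := by
          refine integral_congr_ae (hpt.mono fun x hx => ?_)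
          simp only [hx]
      _ ≤ ∫ x, ∫ y, |k y * (u (x - y) - u x)| := by
          refine integral_mono_of_nonneg (Eventually.of_forall fun x => abs_nonneg _)
            hF.abs.integral_prod_left (Eventually.of_forall fun x => ?_)
          simp only [← Real.norm_eq_abs]
          exact norm_integral_le_integral_norm _
      _ = ∫ y, ∫ x, |k y * (u (x - y) - u x)| := integral_integral_swap hF.abs
      _ = ∫ y, k y * N y := by
          refine integral_congr_ae (Eventually.of_forall fun y => ?_)
          simp only [abs_mul, abs_of_nonneg (hk0 y), hN]
          rw [integral_const_mul]
  rw [L1.norm_eq_integral_norm]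
  refine hkN.trans ?_
  have hind : Integrable ({y : Plane | δ < ‖y‖}.indicator k) := hk.indicator hmS
  calc ∫ y, k y * N y
      ≤ ∫ y, (η / 2 * k y + 2 * ‖u‖ * {y : Plane | δ < ‖y‖}.indicator k y) := by
        refine integral_mono_of_nonneg (Eventually.of_forall fun y =>
          mul_nonneg (hk0 y) (integral_nonneg fun x => abs_nonneg _))
          ((hk.const_mul _).add (hind.const_mul _)) (Eventually.of_forall fun y => ?_)
        have := hk0 y
        have hu0 := norm_nonneg u
        beta_reduce
        by_cases hy : δ < ‖y‖
        · rw [indicator_of_mem (show y ∈ {y : Plane | δ < ‖y‖} from hy)]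
          nlinarith [hN2 y]
        · rw [indicator_of_notMem (show y ∉ {y : Plane | δ < ‖y‖} from hy)]
          nlinarith [hN1 y hy]
    _ = η / 2 + 2 * ‖u‖ * ∫ y in {y | δ < ‖y‖}, k y := by
        rw [integral_add (hk.const_mul _) (hind.const_mul _), integral_const_mul,
          integral_const_mul, hk1, mul_one, integral_indicator hmS]
    _ ≤ η / 2 + 2 * ‖u‖ * (η / (4 * (‖u‖ + 1))) := by
        gcongr
        exact htail.trans (min_le_right _ _)
    _ ≤ η := by
        have : 2 * ‖u‖ * (η / (4 * (‖u‖ + 1))) = η / 2 * (‖u‖ / (‖u‖ + 1)) := by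
          field_simp; ring
        rw [this]
        have h3 : ‖u‖ / (‖u‖ + 1) ≤ 1 := (div_le_one (by positivity)).2 (by linarith)
        nlinarith

end Convolution

/-! ### The functional `u ↦ ‖u⁻‖`. -/

section NegPart

/-- From `T u = T u⁺ - T u⁻` with both terms nonnegative, `(T u)⁻ ≤ T u⁻`. -/
theorem negPart_map_le {T : L1 →L[ℝ] L1} (hT : ∀ u, 0 ≤ u → 0 ≤ T u) {c : ℝ}
    (hc : ∀ u, ‖T u‖ ≤ c * ‖u‖) (u : L1) : ‖(T u)⁻‖ ≤ c * ‖u⁻‖ := by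
  refine le_trans ?_ (hc u⁻)
  have h1 : 0 ≤ T u⁻ := hT _ (negPart_nonneg u)
  refine norm_le_norm_of_abs_le_abs ?_
  rw [abs_of_nonneg (negPart_nonneg _), abs_of_nonneg h1, negPart_def]
  refine sup_le ?_ h1
  have h2 : 0 ≤ T u⁺ := hT _ (posPart_nonneg u)
  have h3 : T u = T u⁺ - T u⁻ := by rw [← map_sub, posPart_sub_negPart]
  rw [h3, neg_sub]
  exact sub_le_self _ h2

theorem norm_negPart_le (u : L1) : ‖u⁻‖ ≤ ‖u‖ := by
  refine norm_le_norm_of_abs_le_abs ?_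
  rw [abs_of_nonneg (negPart_nonneg _), ← posPart_add_negPart u]
  exact le_add_of_nonneg_left (posPart_nonneg u)

theorem norm_negPart_add_le (u v : L1) : ‖(u + v)⁻‖ ≤ ‖u⁻‖ + ‖v⁻‖ := by
  refine le_trans ?_ (norm_add_le _ _)
  have h1 : 0 ≤ u⁻ + v⁻ := add_nonneg (negPart_nonneg u) (negPart_nonneg v)
  refine norm_le_norm_of_abs_le_abs ?_
  rw [abs_of_nonneg (negPart_nonneg _), abs_of_nonneg h1, negPart_def]
  refine sup_le ?_ h1
  rw [neg_add]
  exact add_le_add (neg_le_negPart u) (neg_le_negPart v)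

end NegPart

/-! ### Pairing convolutions with test functions. -/

section TestFunctions

theorem exists_abs_le_of_hasCompactSupport {φ : Plane → ℝ} (hφ : Continuous φ)
    (hc : HasCompactSupport φ) : ∃ M, ∀ x, |φ x| ≤ M :=
  hc.exists_bound_of_continuous hφ

theorem continuous_fderiv_apply {φ : Plane → ℝ} (hφ : ContDiff ℝ ∞ φ) (v : Plane) :
    Continuous fun x => fderiv ℝ φ x v :=
  (hφ.continuous_fderiv (by simp)).clm_apply continuous_const

theorem integral_convFn_mul {k f ψ : Plane → ℝ} (hk : Integrable k) (hf : Integrable f)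
    (hψ : Continuous ψ) {M : ℝ} (hM : ∀ x, |ψ x| ≤ M) :
    ∫ x, convFn k f x * ψ x = ∫ z, f z * ∫ x, k (x - z) * ψ x := by
  have h1 : Integrable (fun p : Plane × Plane => ψ p.1 * (f p.2 * k (p.1 - p.2)))
      (volume.prod volume) :=
    (hf.convolution_integrand (ContinuousLinearMap.mul ℝ ℝ) hk).bdd_mul
      (hψ.comp continuous_fst).aestronglyMeasurable (Eventually.of_forall fun p => hM p.1)
  calc ∫ x, convFn k f x * ψ x = ∫ x, ∫ z, ψ x * (f z * k (x - z)) := by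
        refine integral_congr_ae (Eventually.of_forall fun x => ?_)
        simp only [convFn_apply]
        rw [integral_const_mul, mul_comm]
    _ = ∫ z, ∫ x, ψ x * (f z * k (x - z)) := integral_integral_swap h1
    _ = ∫ z, f z * ∫ x, k (x - z) * ψ x := by
        refine integral_congr_ae (Eventually.of_forall fun z => ?_)
        simp only
        rw [← integral_const_mul]
        congr 1
        ext x
        ring

end TestFunctions

/-! ### Continuity of `L¹`-valued families of functions. -/

section ToL1

/-- The class in `L¹` of an integrable function, and `0` for other functions. -/
def mkL1 (f : Plane → ℝ) : L1 :=
  open Classical in if h : Integrable f volume then h.toL1 f else 0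

theorem mkL1_of_integrable {f : Plane → ℝ} (h : Integrable f volume) : mkL1 f = h.toL1 f :=
  dif_pos h

theorem coeFn_mkL1 {f : Plane → ℝ} (h : Integrable f volume) : mkL1 f =ᵐ[volume] f := by
  rw [mkL1_of_integrable h]
  exact h.coeFn_toL1

theorem continuousAt_mkL1 {k : ℝ → Plane → ℝ} {t : ℝ} {b : Plane → ℝ}
    (hb : Integrable b) (hk : ∀ᶠ s in 𝓝 t, Continuous (k s)) (hkb : ∀ᶠ s in 𝓝 t, ∀ x, |k s x| ≤ b x)
    (hc : ∀ x, ContinuousAt (fun s => k s x) t) : ContinuousAt (fun s => mkL1 (k s)) t := by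
  have hint : ∀ᶠ s in 𝓝 t, Integrable (k s) volume := by
    filter_upwards [hk, hkb] with s h1 h2
    exact hb.mono' h1.aestronglyMeasurable (Eventually.of_forall h2)
  have hit := hint.self_of_nhds
  rw [ContinuousAt, tendsto_iff_norm_sub_tendsto_zero]
  have h1 : Tendsto (fun s => ∫ x, |k s x - k t x|) (𝓝 t) (𝓝 (∫ _ : Plane, (0 : ℝ))) := by
    refine tendsto_integral_filter_of_dominated_convergence (fun x => b x + b x) ?_ ?_
      (hb.add hb) (Eventually.of_forall fun x => ?_)
    · filter_upwards [hint] with s hs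
      exact (hs.sub hit).abs.aestronglyMeasurable
    · filter_upwards [hkb] with s hs
      refine Eventually.of_forall fun x => ?_
      rw [Real.norm_eq_abs, abs_abs]
      exact (abs_sub _ _).trans (add_le_add (hs x) (hkb.self_of_nhds x))
    · simpa using ((hc x).sub_const (k t x)).abs
  rw [integral_zero] at h1
  refine h1.congr' ?_
  filter_upwards [hint] with s hs
  rw [mkL1_of_integrable hs, norm_sub_toL1]
  refine integral_congr_ae ((coeFn_mkL1 hit).mono fun x hx => ?_)
  simp only [hx]

end ToL1

/-! ### The heat kernel, its gradient and the heat semigroup. -/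

section HeatKernel

variable {ε : ℝ}

theorem heatKernel_nonneg (ε : ℝ) {t : ℝ} (ht : 0 < t) (x : Plane) : 0 ≤ heatKernel ε t x := by
  unfold heatKernel
  positivity

theorem continuous_heatKernel (ε t : ℝ) : Continuous (heatKernel ε t) := by
  unfold heatKernel
  fun_prop

theorem integral_heatKernel (hε : 0 < ε) {t : ℝ} (ht : 0 < t) : ∫ x, heatKernel ε t x = 1 := by
  have hb : 0 < 1 / (4 * ε ^ 2 * t) := by positivity
  have h := GaussianFourier.integral_rexp_neg_mul_sq_norm (V := Plane) hb
  unfold heatKernel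
  rw [integral_const_mul]
  have h2 : (∫ x : Plane, Real.exp (-‖x‖ ^ 2 / (4 * ε ^ 2 * t))) = 4 * Real.pi * ε ^ 2 * t := by
    have h3 : ∀ x : Plane, Real.exp (-‖x‖ ^ 2 / (4 * ε ^ 2 * t))
        = Real.exp (-(1 / (4 * ε ^ 2 * t)) * ‖x‖ ^ 2) := fun x => by congr 1; ring
    simp only [h3]
    rw [h]
    simp only [finrank_euclideanSpace, Fintype.card_fin, Nat.cast_ofNat]
    rw [div_self (two_ne_zero), Real.rpow_one]
    field_simp
  rw [h2]
  have := Real.pi_pos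
  field_simp

/-- A dominating function uniform for `s` near `t`, for the continuity of the kernel in `L¹` with
respect to time. -/
theorem heatKernel_le_four_mul (hε : 0 < ε) {s t : ℝ} (h1 : t / 2 < s) (h2 : s < 2 * t)
    (x : Plane) : heatKernel ε s x ≤ 4 * heatKernel ε (2 * t) x := by
  have ht : 0 < t := by linarith
  have hs : 0 < s := by linarith
  have hpi := Real.pi_pos
  unfold heatKernel
  rw [← mul_assoc]
  refine mul_le_mul ?_ (Real.exp_le_exp.2 ?_) (Real.exp_pos _).le (by positivity)
  · rw [mul_one_div, div_le_div_iff₀ (by positivity) (by positivity)]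
    have : 0 < Real.pi * ε ^ 2 := by positivity
    nlinarith
  · rw [neg_div, neg_div, neg_le_neg_iff]
    gcongr

/-- Completing the square in `z`. Integrating out the second factor, a translated probability
density, gives the semigroup law. -/
theorem heatKernel_mul_heatKernel (hε : 0 < ε) {s t : ℝ} (hs : 0 < s) (ht : 0 < t) (x z : Plane) :
    heatKernel ε t z * heatKernel ε s (x - z)
      = heatKernel ε (s + t) x * heatKernel ε (s * t / (s + t)) (z - (t / (s + t)) • x) := by
  have hpi := Real.pi_pos
  unfold heatKernel
  rw [mul_mul_mul_comm, ← Real.exp_add, mul_mul_mul_comm _ _ _ (Real.exp _), ← Real.exp_add]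
  congr 1
  · field_simp
  · congr 1
    rw [norm_sub_sq_real, norm_sub_sq_real, norm_smul, inner_smul_right, real_inner_comm x z,
      Real.norm_of_nonneg (by positivity)]
    field_simp
    ring

theorem convFn_heatKernel (hε : 0 < ε) {s t : ℝ} (hs : 0 < s) (ht : 0 < t) :
    convFn (heatKernel ε s) (heatKernel ε t) = heatKernel ε (s + t) := by
  ext x
  simp only [convFn_apply, heatKernel_mul_heatKernel hε hs ht]
  rw [integral_const_mul, integral_sub_right_eq_self (heatKernel ε (s * t / (s + t))),
    integral_heatKernel hε (by positivity), mul_one]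

/-- The partial derivative `∂ᵢ` of the heat kernel. -/
def gradKernel (ε : ℝ) (i : Fin 2) (t : ℝ) (x : Plane) : ℝ :=
  -(x i) / (2 * ε ^ 2 * t) * heatKernel ε t x

theorem continuous_gradKernel (ε : ℝ) (i : Fin 2) (t : ℝ) : Continuous (gradKernel ε i t) := by
  unfold gradKernel
  have := continuous_heatKernel ε t
  fun_prop

theorem hasFDerivAt_heatKernel (ε t : ℝ) (x : Plane) :
    HasFDerivAt (heatKernel ε t) ((-(heatKernel ε t x) / (2 * ε ^ 2 * t)) • innerSL ℝ x) x := by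
  have h1 := (((hasStrictFDerivAt_norm_sq x).hasFDerivAt.neg.mul_const
    ((4 * ε ^ 2 * t)⁻¹)).exp).const_mul (1 / (4 * Real.pi * ε ^ 2 * t))
  refine (h1.congr_fderiv ?_).congr_of_eventuallyEq (Eventually.of_forall fun y => ?_)
  · ext v
    simp only [heatKernel, smul_apply, neg_apply, smul_eq_mul, innerSL_apply_apply, nsmul_eq_mul,
      Nat.cast_ofNat, div_eq_mul_inv, mul_inv, Pi.neg_apply]
    ring
  · simp [heatKernel, div_eq_mul_inv]

theorem fderiv_heatKernel (ε t : ℝ) (i : Fin 2) (x : Plane) :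
    fderiv ℝ (heatKernel ε t) x (e i) = gradKernel ε i t x := by
  rw [(hasFDerivAt_heatKernel ε t x).fderiv]
  simp only [smul_apply, smul_eq_mul, innerSL_apply_apply, gradKernel, e,
    EuclideanSpace.inner_single_right]
  simp
  ring

/-- The Gaussian is a product of two equal factors `E`: one absorbs the linear factor `|x|` at the
price of `√t`, the other is the Gaussian at time `2t`. The rate `t^{-1/2}`, integrable at `0`, makes
the drift a small perturbation of the diffusion. -/
theorem abs_gradKernel_le (hε : 0 < ε) (i : Fin 2) {t : ℝ} (ht : 0 < t) (x : Plane) :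
    |gradKernel ε i t x| ≤ 3 / (ε * √t) * heatKernel ε (2 * t) x := by
  have hpi := Real.pi_pos
  have hst : 0 < √t := Real.sqrt_pos.2 ht
  have hsq : √t ^ 2 = t := Real.sq_sqrt ht.le
  have hxi : |x i| ≤ ‖x‖ := by
    simpa using PiLp.norm_apply_le x i
  set r := ‖x‖
  have hr : 0 ≤ r := norm_nonneg x
  set E := Real.exp (-r ^ 2 / (4 * ε ^ 2 * (2 * t))) with hE
  have hE0 : 0 < E := Real.exp_pos _
  have hEE : Real.exp (-r ^ 2 / (4 * ε ^ 2 * t)) = E * E := by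
    rw [hE, ← Real.exp_add]
    congr 1
    field_simp
    ring
  -- With `y = r/(3ε√t)`, `y ≤ 1 + y² ≤ exp(r²/(8ε²t)) = 1/E`; the constant `3` works because `9 ≥
  -- 8`.
  have hrE : r * E ≤ 3 * ε * √t := by
    set y := r / (3 * ε * √t) with hy
    have hry : r = y * (3 * ε * √t) := by rw [hy]; field_simp
    have h1 : y * E ≤ 1 := by
      have hy0 : 0 ≤ y := by positivity
      have h2 : 1 + y ^ 2 ≤ Real.exp (r ^ 2 / (4 * ε ^ 2 * (2 * t))) := by
        refine le_trans ?_ (Real.add_one_le_exp _)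
        rw [add_comm]
        gcongr
        rw [hry, mul_pow, mul_pow, mul_pow, hsq, le_div_iff₀ (by positivity)]
        have : 0 ≤ y ^ 2 * (ε ^ 2 * t) := by positivity
        nlinarith
      have h3 : Real.exp (r ^ 2 / (4 * ε ^ 2 * (2 * t))) * E = 1 := by
        rw [hE, ← Real.exp_add, neg_div, add_neg_cancel, Real.exp_zero]
      have h4 : y ≤ 1 + y ^ 2 := by nlinarith [sq_nonneg (y - 1)]
      rw [← h3]
      gcongr
      exact h4.trans h2
    calc r * E = (y * E) * (3 * ε * √t) := by rw [hry]; ring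
      _ ≤ 1 * (3 * ε * √t) := by gcongr
      _ = _ := one_mul _
  have hK : heatKernel ε (2 * t) x = 1 / (4 * Real.pi * ε ^ 2 * (2 * t)) * E := rfl
  have hK2 : heatKernel ε t x = 1 / (4 * Real.pi * ε ^ 2 * t) * (E * E) := by
    rw [← hEE]; rfl
  rw [gradKernel, abs_mul, abs_div, abs_neg, abs_of_nonneg (heatKernel_nonneg ε ht x),
    abs_of_pos (by positivity : 0 < 2 * ε ^ 2 * t), hK, hK2]
  calc |x i| / (2 * ε ^ 2 * t) * (1 / (4 * Real.pi * ε ^ 2 * t) * (E * E))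
      ≤ r / (2 * ε ^ 2 * t) * (1 / (4 * Real.pi * ε ^ 2 * t) * (E * E)) := by gcongr
    _ = (r * E) * (1 / (2 * ε ^ 2 * t) * (1 / (4 * Real.pi * ε ^ 2 * t) * E)) := by ring
    _ ≤ (3 * ε * √t) * (1 / (2 * ε ^ 2 * t) * (1 / (4 * Real.pi * ε ^ 2 * t) * E)) := by gcongr
    _ = _ := by
      nth_rewrite 2 [← hsq]
      field_simp

theorem integrable_gradKernel (hε : 0 < ε) (i : Fin 2) {t : ℝ} (ht : 0 < t) :
    Integrable (gradKernel ε i t) volume :=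
  ((integrable_heatKernel ε (by positivity : 0 < 2 * t)).const_mul _).mono'
    (continuous_gradKernel ε i t).aestronglyMeasurable
    (Eventually.of_forall (abs_gradKernel_le hε i ht))

theorem integral_abs_gradKernel_le (hε : 0 < ε) (i : Fin 2) {t : ℝ} (ht : 0 < t) :
    ∫ x, |gradKernel ε i t x| ≤ 3 / (ε * √t) := by
  have h2t : 0 < 2 * t := by positivity
  refine (integral_mono_of_nonneg (Eventually.of_forall fun x => abs_nonneg _)
    ((integrable_heatKernel ε h2t).const_mul _)
    (Eventually.of_forall (abs_gradKernel_le hε i ht))).trans ?_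
  rw [integral_const_mul, integral_heatKernel hε h2t, mul_one]

theorem setIntegral_heatKernel_le (hε : 0 < ε) {t δ : ℝ} (ht : 0 < t) (hδ : 0 < δ) :
    ∫ y in {y : Plane | δ < ‖y‖}, heatKernel ε t y ≤ 2 * Real.exp (-(δ ^ 2 / (8 * ε ^ 2) * t⁻¹)) := by
  have h2t : 0 < 2 * t := by positivity
  have hpi := Real.pi_pos
  have hm : MeasurableSet {y : Plane | δ < ‖y‖} :=
    (isOpen_lt continuous_const continuous_norm).measurableSet
  have h1 : ∀ y ∈ {y : Plane | δ < ‖y‖}, heatKernel ε t y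
      ≤ 2 * Real.exp (-(δ ^ 2 / (8 * ε ^ 2) * t⁻¹)) * heatKernel ε (2 * t) y := by
    intro y hy
    have hy' : δ < ‖y‖ := hy
    have h2 : Real.exp (-‖y‖ ^ 2 / (4 * ε ^ 2 * t))
        ≤ Real.exp (-(δ ^ 2 / (8 * ε ^ 2) * t⁻¹)) * Real.exp (-‖y‖ ^ 2 / (4 * ε ^ 2 * (2 * t))) := by
      rw [← Real.exp_add, Real.exp_le_exp]
      have h3 : -‖y‖ ^ 2 / (4 * ε ^ 2 * t) = -(‖y‖ ^ 2 / (8 * ε ^ 2) * t⁻¹)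
          + -‖y‖ ^ 2 / (4 * ε ^ 2 * (2 * t)) := by field_simp; ring
      rw [h3]
      gcongr
    unfold heatKernel
    calc _ ≤ 1 / (4 * Real.pi * ε ^ 2 * t) * (Real.exp (-(δ ^ 2 / (8 * ε ^ 2) * t⁻¹))
          * Real.exp (-‖y‖ ^ 2 / (4 * ε ^ 2 * (2 * t)))) := by gcongr
      _ = _ := by field_simp
  have hi := (integrable_heatKernel ε h2t).const_mul (2 * Real.exp (-(δ ^ 2 / (8 * ε ^ 2) * t⁻¹)))
  calc _ ≤ ∫ y in {y : Plane | δ < ‖y‖},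
        2 * Real.exp (-(δ ^ 2 / (8 * ε ^ 2) * t⁻¹)) * heatKernel ε (2 * t) y :=
        setIntegral_mono_on (integrable_heatKernel ε ht).integrableOn hi.integrableOn hm h1
    _ ≤ ∫ y, 2 * Real.exp (-(δ ^ 2 / (8 * ε ^ 2) * t⁻¹)) * heatKernel ε (2 * t) y :=
        setIntegral_le_integral hi (Eventually.of_forall fun y =>
          mul_nonneg (by positivity) (heatKernel_nonneg ε h2t y))
    _ = _ := by rw [integral_const_mul, integral_heatKernel hε h2t, mul_one]

/-- The heat kernel as an element of `L¹`. -/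
def heatK (ε t : ℝ) : L1 := mkL1 (heatKernel ε t)

/-- The partial derivative of the heat kernel as an element of `L¹`. -/
def gradK (ε : ℝ) (i : Fin 2) (t : ℝ) : L1 := mkL1 (gradKernel ε i t)

theorem norm_heatK (hε : 0 < ε) {t : ℝ} (ht : 0 < t) : ‖heatK ε t‖ = 1 := by
  rw [heatK, mkL1_of_integrable (integrable_heatKernel ε ht), norm_toL1]
  simp only [abs_of_nonneg (heatKernel_nonneg ε ht _)]
  exact integral_heatKernel hε ht

theorem norm_gradK_le (hε : 0 < ε) (i : Fin 2) {t : ℝ} (ht : 0 < t) :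
    ‖gradK ε i t‖ ≤ 3 / (ε * √t) := by
  rw [gradK, mkL1_of_integrable (integrable_gradKernel hε i ht), norm_toL1]
  exact integral_abs_gradKernel_le hε i ht

theorem heatK_nonneg (ε : ℝ) {t : ℝ} (ht : 0 < t) : 0 ≤ heatK ε t := by
  rw [heatK, mkL1_of_integrable (integrable_heatKernel ε ht)]
  exact nonneg_toL1 _ (Eventually.of_forall (heatKernel_nonneg ε ht))

theorem heatSemigroup_eq (ε : ℝ) {t : ℝ} (ht : 0 < t) (u : L1) :
    heatSemigroup ε t u = convB (heatK ε t) u := by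
  rw [heatSemigroup, dif_pos ht, heatK, mkL1_of_integrable (integrable_heatKernel ε ht)]
  apply Lp.ext
  filter_upwards [(integrable_heatConv ε ht u).coeFn_toL1,
    coeFn_convB_toL1 (integrable_heatKernel ε ht) u] with x h1 h2
  rw [h1, h2, heatConv, convFn_apply]
  simp only [mul_comm]

theorem convB_heatK_heatK (hε : 0 < ε) {s t : ℝ} (hs : 0 < s) (ht : 0 < t) :
    convB (heatK ε s) (heatK ε t) = heatK ε (s + t) := by
  apply Lp.ext
  filter_upwards [coeFn_convB (heatK ε s) (heatK ε t),
    coeFn_mkL1 (integrable_heatKernel ε (add_pos hs ht))] with x h1 h2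
  rw [h1, heatK, heatK, convFn_congr (coeFn_mkL1 (integrable_heatKernel ε hs))
    (coeFn_mkL1 (integrable_heatKernel ε ht)), convFn_heatKernel hε hs ht]
  exact h2.symm

theorem continuousOn_heatK (hε : 0 < ε) : ContinuousOn (heatK ε) (Ioi 0) := by
  intro t ht
  have ht' : 0 < t := ht
  refine ContinuousAt.continuousWithinAt (continuousAt_mkL1
    ((integrable_heatKernel ε (by positivity : 0 < 2 * t)).const_mul 4)
    (Eventually.of_forall fun s => continuous_heatKernel ε s) ?_ fun x => ?_)
  · filter_upwards [Ioo_mem_nhds (half_lt_self ht') (by linarith : t < 2 * t)] with s hs x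
    rw [abs_of_nonneg (heatKernel_nonneg ε (by linarith [hs.1]) x)]
    exact heatKernel_le_four_mul hε hs.1 hs.2 x
  · unfold heatKernel
    have := Real.pi_pos
    fun_prop (disch := positivity)

theorem continuousOn_gradK (hε : 0 < ε) (i : Fin 2) : ContinuousOn (gradK ε i) (Ioi 0) := by
  intro t ht
  have ht' : 0 < t := ht
  refine ContinuousAt.continuousWithinAt (continuousAt_mkL1
    (((integrable_heatKernel ε (by positivity : 0 < 2 * (2 * t))).const_mul 4).const_mul
      (3 / (ε * √(t / 2))))
    (Eventually.of_forall fun s => continuous_gradKernel ε i s) ?_ fun x => ?_)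
  · filter_upwards [Ioo_mem_nhds (half_lt_self ht') (by linarith : t < 2 * t)] with s hs x
    have hs0 : 0 < s := by linarith [hs.1]
    refine (abs_gradKernel_le hε i hs0 x).trans ?_
    have h1 : 0 < √(t / 2) := Real.sqrt_pos.2 (by positivity)
    have h2 : √(t / 2) ≤ √s := Real.sqrt_le_sqrt hs.1.le
    have h3 := heatKernel_le_four_mul hε (s := 2 * s) (t := 2 * t) (by linarith [hs.1])
      (by linarith [hs.2]) x
    have h4 := heatKernel_nonneg ε (by positivity : 0 < 2 * s) x
    gcongr
  · unfold gradKernel heatKernel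
    have := Real.pi_pos
    fun_prop (disch := positivity)

theorem tendsto_heatSemigroup (hε : 0 < ε) (u : L1) :
    Tendsto (fun t => heatSemigroup ε t u) (𝓝[>] 0) (𝓝 u) := by
  rw [Metric.tendsto_nhds]
  intro η hη
  obtain ⟨δ, hδ, h⟩ := exists_norm_convB_sub_le u (η := η / 2) (by positivity)
  have h1 : Tendsto (fun t : ℝ => 2 * Real.exp (-(δ ^ 2 / (8 * ε ^ 2) * t⁻¹))) (𝓝[>] 0)
      (𝓝 (2 * 0)) :=
    (Real.tendsto_exp_neg_atTop_nhds_zero.comp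
      (tendsto_inv_nhdsGT_zero.const_mul_atTop (by positivity))).const_mul 2
  rw [mul_zero] at h1
  filter_upwards [h1.eventually (gt_mem_nhds hδ), self_mem_nhdsWithin] with t ht ht0
  have ht0' : 0 < t := ht0
  rw [heatSemigroup_eq ε ht0', heatK, mkL1_of_integrable (integrable_heatKernel ε ht0'),
    dist_eq_norm]
  refine (h _ (integrable_heatKernel ε ht0') (heatKernel_nonneg ε ht0')
    (integral_heatKernel hε ht0') ((setIntegral_heatKernel_le hε ht0' hδ).trans ht.le)).trans_lt ?_
  linarith

/-- Fubini moves the test function onto the kernel, where classical integration by parts applies. -/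
theorem isWeakPartial_heatK (hε : 0 < ε) (i : Fin 2) {t : ℝ} (ht : 0 < t) (f : L1) :
    IsWeakPartial i (convB (heatK ε t) f) (convB (gradK ε i t) f) := by
  intro φ hφ hφc
  obtain ⟨M, hM⟩ := exists_abs_le_of_hasCompactSupport hφ.continuous hφc
  have hdc := continuous_fderiv_apply hφ (e i)
  obtain ⟨M', hM'⟩ := exists_abs_le_of_hasCompactSupport hdc
    (hφc.fderiv_apply ℝ (e i))
  have hk := integrable_heatKernel ε ht
  have hg := integrable_gradKernel hε i ht
  have hf := L1.integrable_coeFn f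
  have e1 : ∫ x, (convB (heatK ε t) f : L1) x * fderiv ℝ φ x (e i)
      = ∫ x, convFn (heatKernel ε t) f x * fderiv ℝ φ x (e i) := by
    rw [heatK, mkL1_of_integrable hk]
    refine integral_congr_ae ((coeFn_convB_toL1 hk f).mono fun x hx => ?_)
    simp only [hx]
  have e2 : ∫ x, (convB (gradK ε i t) f : L1) x * φ x
      = ∫ x, convFn (gradKernel ε i t) f x * φ x := by
    rw [gradK, mkL1_of_integrable hg]
    refine integral_congr_ae ((coeFn_convB_toL1 hg f).mono fun x hx => ?_)
    simp only [hx]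
  rw [e1, e2, integral_convFn_mul hk hf hdc hM', integral_convFn_mul hg hf hφ.continuous hM,
    ← integral_neg]
  refine integral_congr_ae (Eventually.of_forall fun z => ?_)
  simp only
  rw [← mul_neg]
  congr 1
  have hd' : ∀ x, HasFDerivAt (fun x => heatKernel ε t (x - z))
      (fderiv ℝ (heatKernel ε t) (x - z)) x := fun x =>
    (hasFDerivAt_comp_sub z).2 (hasFDerivAt_heatKernel ε t (x - z)).differentiableAt.hasFDerivAt
  have hd : ∀ x, fderiv ℝ (fun x => heatKernel ε t (x - z)) x (e i) = gradKernel ε i t (x - z) := by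
    intro x
    rw [(hd' x).fderiv, fderiv_heatKernel]
  have := integral_mul_fderiv_eq_neg_fderiv_mul_of_integrable (μ := (volume : Measure Plane))
    (f := fun x => heatKernel ε t (x - z)) (g := φ) (v := e i) ?_ ?_ ?_ ?_ ?_
  · simp only [hd] at this
    exact this
  · simp only [hd]
    exact (hg.comp_sub_right z).mul_bdd hφ.continuous.aestronglyMeasurable
      (Eventually.of_forall hM)
  · exact (hk.comp_sub_right z).mul_bdd hdc.aestronglyMeasurable (Eventually.of_forall hM')
  · exact (hk.comp_sub_right z).mul_bdd hφ.continuous.aestronglyMeasurable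
      (Eventually.of_forall hM)
  · intro x _
    exact (hd' x).differentiableAt
  · intro x _
    exact (hφ.differentiable (by simp)) x

end HeatKernel

/-! ### Uniqueness of weak derivatives. -/

section WeakPartial

theorem IsWeakPartial.unique {i : Fin 2} {u g g' : L1} (h : IsWeakPartial i u g)
    (h' : IsWeakPartial i u g') : g = g' := by
  have hi : Integrable (fun x => g x - g' x) volume :=
    (L1.integrable_coeFn g).sub (L1.integrable_coeFn g')
  have h0 := ae_eq_zero_of_integral_contDiff_smul_eq_zero (μ := (volume : Measure Plane))
    hi.locallyIntegrable fun φ hφ hc => by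
      obtain ⟨M, hM⟩ := exists_abs_le_of_hasCompactSupport hφ.continuous hc
      have i1 : Integrable (fun x => g x * φ x) volume := (L1.integrable_coeFn g).mul_bdd
        hφ.continuous.aestronglyMeasurable (Eventually.of_forall hM)
      have i2 : Integrable (fun x => g' x * φ x) volume := (L1.integrable_coeFn g').mul_bdd
        hφ.continuous.aestronglyMeasurable (Eventually.of_forall hM)
      have e1 : ∀ x, φ x • (g x - g' x) = g x * φ x - g' x * φ x := fun x => by
        rw [smul_eq_mul]; ring
      simp only [e1]
      rw [integral_sub i1 i2, sub_eq_zero, ← neg_inj, ← h φ hφ hc, ← h' φ hφ hc]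
  apply Lp.ext
  filter_upwards [h0] with x hx
  exact sub_eq_zero.1 hx

end WeakPartial

/-! ### The resolvent of the heat semigroup as a Laplace transform. -/

section Laplace

variable {ε : ℝ}

theorem continuous_exp_neg_mul (l : ℝ) : Continuous fun t : ℝ => Real.exp (-l * t) := by
  fun_prop

theorem integrableOn_laplace_heatK (hε : 0 < ε) {l : ℝ} (hl : 0 < l) :
    IntegrableOn (fun t => Real.exp (-l * t) • heatK ε t) (Ioi 0) := by
  have h1 : IntegrableOn (fun t => Real.exp (-l * t)) (Ioi 0) :=
    integrableOn_exp_mul_Ioi (neg_lt_zero.2 hl) 0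
  refine h1.mono' (ContinuousOn.aestronglyMeasurable ?_ measurableSet_Ioi) ?_
  · exact (continuous_exp_neg_mul l).continuousOn.smul (continuousOn_heatK hε)
  · refine (ae_restrict_mem measurableSet_Ioi).mono fun t ht => ?_
    rw [norm_smul, norm_heatK hε ht, mul_one, Real.norm_of_nonneg (Real.exp_pos _).le]

theorem integrableOn_rpow_mul_exp {l : ℝ} (hl : 0 < l) :
    IntegrableOn (fun t : ℝ => t ^ ((1 / 2 : ℝ) - 1) * Real.exp (-(l * t))) (Ioi 0) := by
  -- The integral of a non-integrable function is `0` by convention, whereas the Gamma integral is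
  -- positive.
  refine Integrable.of_integral_ne_zero ?_
  rw [Real.integral_rpow_mul_exp_neg_mul_Ioi (by norm_num) hl]
  have := Real.Gamma_pos_of_pos (by norm_num : (0 : ℝ) < 1 / 2)
  positivity

theorem norm_laplace_gradK_le (hε : 0 < ε) (i : Fin 2) (l : ℝ) {t : ℝ} (ht : 0 < t) :
    ‖Real.exp (-l * t) • gradK ε i t‖
      ≤ 3 / ε * (t ^ ((1 / 2 : ℝ) - 1) * Real.exp (-(l * t))) := by
  rw [norm_smul, Real.norm_of_nonneg (Real.exp_pos _).le]
  refine (mul_le_mul_of_nonneg_left (norm_gradK_le hε i ht) (Real.exp_pos _).le).trans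
    (le_of_eq ?_)
  have h1 : t ^ ((1 / 2 : ℝ) - 1) = (√t)⁻¹ := by
    rw [Real.sqrt_eq_rpow, ← Real.rpow_neg ht.le]
    norm_num
  rw [h1, neg_mul]
  field_simp

theorem integrableOn_laplace_gradK (hε : 0 < ε) (i : Fin 2) {l : ℝ} (hl : 0 < l) :
    IntegrableOn (fun t => Real.exp (-l * t) • gradK ε i t) (Ioi 0) := by
  refine ((integrableOn_rpow_mul_exp hl).const_mul (3 / ε)).mono'
    (ContinuousOn.aestronglyMeasurable ?_ measurableSet_Ioi) ?_
  · exact (continuous_exp_neg_mul l).continuousOn.smul (continuousOn_gradK hε i)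
  · exact (ae_restrict_mem measurableSet_Ioi).mono fun t ht => norm_laplace_gradK_le hε i l ht

/-- The kernel of the resolvent `(l - A)⁻¹` of the heat semigroup. -/
def resK (ε l : ℝ) : L1 := ∫ t in Ioi (0 : ℝ), Real.exp (-l * t) • heatK ε t

/-- The partial derivative of the kernel of the resolvent. -/
def gradResK (ε : ℝ) (i : Fin 2) (l : ℝ) : L1 :=
  ∫ t in Ioi (0 : ℝ), Real.exp (-l * t) • gradK ε i t

theorem norm_resK_le (hε : 0 < ε) {l : ℝ} (hl : 0 < l) : ‖resK ε l‖ ≤ 1 / l := by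
  refine (norm_integral_le_integral_norm _).trans (le_of_eq ?_)
  calc _ = ∫ t in Ioi (0 : ℝ), Real.exp (-l * t) := by
        refine setIntegral_congr_fun measurableSet_Ioi fun t ht => ?_
        simp only [norm_smul, norm_heatK hε ht, mul_one, Real.norm_of_nonneg (Real.exp_pos _).le]
    _ = 1 / l := by
        rw [integral_exp_mul_Ioi (neg_lt_zero.2 hl)]
        simp

theorem norm_gradResK_le (hε : 0 < ε) (i : Fin 2) {l : ℝ} (hl : 0 < l) :
    ‖gradResK ε i l‖ ≤ 3 / ε * ((1 / l) ^ (1 / 2 : ℝ) * Real.Gamma (1 / 2)) := by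
  refine (norm_integral_le_integral_norm _).trans ?_
  rw [← Real.integral_rpow_mul_exp_neg_mul_Ioi (by norm_num) hl, ← integral_const_mul]
  exact setIntegral_mono_on (integrableOn_laplace_gradK hε i hl).norm
    ((integrableOn_rpow_mul_exp hl).const_mul _) measurableSet_Ioi
    fun t ht => norm_laplace_gradK_le hε i l ht

theorem tendsto_norm_gradResK (hε : 0 < ε) (i : Fin 2) :
    Tendsto (fun l => ‖gradResK ε i l‖) atTop (𝓝 0) := by
  have h1 : Tendsto (fun l : ℝ => 3 / ε * ((1 / l) ^ (1 / 2 : ℝ) * Real.Gamma (1 / 2))) atTop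
      (𝓝 (3 / ε * (0 ^ (1 / 2 : ℝ) * Real.Gamma (1 / 2)))) := by
    refine Tendsto.const_mul _ (Tendsto.mul_const _ ?_)
    refine Tendsto.rpow_const ?_ (Or.inr (by norm_num))
    exact (tendsto_inv_atTop_zero (𝕜 := ℝ)).congr fun l => (one_div l).symm
  rw [Real.zero_rpow (by norm_num), zero_mul, mul_zero] at h1
  refine tendsto_of_tendsto_of_tendsto_of_le_of_le' tendsto_const_nhds h1
    (Eventually.of_forall fun l => norm_nonneg _) ?_
  filter_upwards [eventually_gt_atTop 0] with l hl
  exact norm_gradResK_le hε i hl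

theorem tendsto_norm_resK (hε : 0 < ε) : Tendsto (fun l => ‖resK ε l‖) atTop (𝓝 0) := by
  have h1 : Tendsto (fun l : ℝ => 1 / l) atTop (𝓝 0) := by
    exact (tendsto_inv_atTop_zero (𝕜 := ℝ)).congr fun l => (one_div l).symm
  refine tendsto_of_tendsto_of_tendsto_of_le_of_le' tendsto_const_nhds h1
    (Eventually.of_forall fun l => norm_nonneg _) ?_
  filter_upwards [eventually_gt_atTop 0] with l hl
  exact norm_resK_le hε hl

/-- Pairing with a fixed test function is a bounded functional of the kernel, so it commutes with
the Bochner integral in time and the identity reduces to `isWeakPartial_heatK`. -/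
theorem isWeakPartial_resK (hε : 0 < ε) (i : Fin 2) {l : ℝ} (hl : 0 < l) (f : L1) :
    IsWeakPartial i (convB (resK ε l) f) (convB (gradResK ε i l) f) := by
  intro φ hφ hφc
  obtain ⟨M, hM⟩ := exists_abs_le_of_hasCompactSupport hφ.continuous hφc
  have hdc := continuous_fderiv_apply hφ (e i)
  obtain ⟨M', hM'⟩ := exists_abs_le_of_hasCompactSupport hdc (hφc.fderiv_apply ℝ (e i))
  rw [← testL_apply hdc hM', ← testL_apply hφ.continuous hM]
  have e1 := ((testL _ hdc M' hM').comp (convB.flip f)).integral_comp_comm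
    (integrableOn_laplace_heatK hε hl)
  have e2 := ((testL _ hφ.continuous M hM).comp (convB.flip f)).integral_comp_comm
    (integrableOn_laplace_gradK hε i hl)
  simp only [ContinuousLinearMap.comp_apply, ContinuousLinearMap.flip_apply] at e1 e2
  rw [resK, gradResK, ← e1, ← e2, ← integral_neg]
  refine setIntegral_congr_fun measurableSet_Ioi fun t ht => ?_
  simp only [map_smul, smul_apply, testL_apply]
  rw [isWeakPartial_heatK hε i ht f φ hφ hφc, smul_neg]

/-- The semigroup acts on the resolvent kernel by shifting the Laplace transform. -/
theorem convB_heatK_resK (hε : 0 < ε) {l h : ℝ} (hl : 0 < l) (hh : 0 < h) :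
    convB (heatK ε h) (resK ε l) = Real.exp (l * h) •
      (resK ε l - ∫ t in (0 : ℝ)..h, Real.exp (-l * t) • heatK ε t) := by
  have hint := integrableOn_laplace_heatK hε hl
  have h1 : convB (heatK ε h) (resK ε l)
      = ∫ t in Ioi (0 : ℝ), Real.exp (l * h) • (Real.exp (-l * (t + h)) • heatK ε (t + h)) := by
    rw [resK, ← (convB (heatK ε h)).integral_comp_comm hint]
    refine setIntegral_congr_fun measurableSet_Ioi fun t ht => ?_
    simp only [map_smul]
    rw [convB_heatK_heatK hε hh ht, smul_smul, ← Real.exp_add, add_comm h t]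
    congr 2
    ring
  have h2 : ∫ t in Ioi (0 : ℝ), Real.exp (-l * (t + h)) • heatK ε (t + h)
      = ∫ t in Ioi h, Real.exp (-l * t) • heatK ε t := by
    rw [← (measurePreserving_add_right volume h).setIntegral_preimage_emb
      (measurableEmbedding_addRight h) (fun t => Real.exp (-l * t) • heatK ε t) (Ioi h)]
    simp
  have h3 : resK ε l = (∫ t in (0 : ℝ)..h, Real.exp (-l * t) • heatK ε t)
      + ∫ t in Ioi h, Real.exp (-l * t) • heatK ε t := by
    rw [intervalIntegral.integral_of_le hh.le, resK, ← Ioc_union_Ioi_eq_Ioi hh.le,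
      setIntegral_union (Ioc_disjoint_Ioi le_rfl) measurableSet_Ioi
        (hint.mono_set Ioc_subset_Ioi_self) (hint.mono_set (Ioi_subset_Ioi hh.le))]
  rw [h1, integral_smul, h2, h3]
  congr 1
  abel

theorem tendsto_laplace_average (hε : 0 < ε) {l : ℝ} (hl : 0 < l) (f : L1) :
    Tendsto (fun h : ℝ => h⁻¹ • convB (∫ t in (0 : ℝ)..h, Real.exp (-l * t) • heatK ε t) f)
      (𝓝[>] 0) (𝓝 f) := by
  have hint := integrableOn_laplace_heatK hε hl
  -- `heatSemigroup` is the identity at `t = 0`, so `F 0 = f` is the right-hand limit there; `heatK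
  -- ε 0` is `0`, hence would give the wrong value.
  set F : ℝ → L1 := fun t => Real.exp (-l * t) • heatSemigroup ε t f with hF
  have hFeq : ∀ t ∈ Ioi (0 : ℝ), F t = Real.exp (-l * t) • convB (heatK ε t) f := fun t ht => by
    rw [hF, ← heatSemigroup_eq ε ht]
  have hF0 : F 0 = f := by simp [hF, heatSemigroup]
  have hcont : ContinuousWithinAt F (Ioi 0) 0 := by
    rw [ContinuousWithinAt, hF0]
    have h1 : Tendsto (fun t : ℝ => Real.exp (-l * t)) (𝓝[>] 0) (𝓝 1) := by
      have : Continuous fun t : ℝ => Real.exp (-l * t) := by fun_prop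
      simpa using (this.tendsto 0).mono_left nhdsWithin_le_nhds
    simpa only [one_smul] using h1.smul (tendsto_heatSemigroup hε f)
  have hFc : ContinuousOn F (Ioi 0) := by
    refine ContinuousOn.congr ?_ hFeq
    exact (continuous_exp_neg_mul l).continuousOn.smul
      ((convB.continuous.comp_continuousOn (continuousOn_heatK hε)).clm_apply continuousOn_const)
  have hmeas : StronglyMeasurableAtFilter F (𝓝[>] 0) volume :=
    ⟨Ioi 0, self_mem_nhdsWithin, hFc.aestronglyMeasurable measurableSet_Ioi⟩
  have hd := intervalIntegral.integral_hasDerivWithinAt_right (a := (0 : ℝ)) (b := 0) (f := F)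
    IntervalIntegrable.refl (s := Ici 0) (t := Ioi 0) hmeas hcont
  have hs := (hasDerivWithinAt_iff_tendsto_slope' (self_notMem_Ioi)).1 (hd.mono Ioi_subset_Ici_self)
  rw [hF0] at hs
  refine hs.congr' ?_
  filter_upwards [self_mem_nhdsWithin] with h hh
  have hh' : 0 < h := hh
  rw [slope_def_module, intervalIntegral.integral_same, sub_zero, sub_zero]
  congr 1
  have e1 := (convB.flip f).intervalIntegral_comp_comm (μ := volume) (a := 0) (b := h)
    (f := fun t => Real.exp (-l * t) • heatK ε t)
    ((intervalIntegrable_iff_integrableOn_Ioc_of_le hh'.le).2 (hint.mono_set Ioc_subset_Ioi_self))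
  simp only [ContinuousLinearMap.flip_apply, map_smul] at e1
  rw [← e1]
  refine intervalIntegral.integral_congr_ae (Eventually.of_forall fun t ht => ?_)
  rw [uIoc_of_le hh'.le] at ht
  rw [hFeq t ht.1]

/-- Differentiate `convB_heatK_resK` at `h = 0`: the factor `e^{lh}` contributes `l`, the average
over `[0, h]` contributes `-f`. -/
theorem isHeatGenerator_resK (hε : 0 < ε) {l : ℝ} (hl : 0 < l) (f : L1) :
    IsHeatGenerator ε (convB (resK ε l) f) (l • convB (resK ε l) f - f) := by
  have h1 : Tendsto (fun h : ℝ => h⁻¹ * (Real.exp (l * h) - 1)) (𝓝[>] 0) (𝓝 l) := by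
    have hd : HasDerivAt (fun h : ℝ => Real.exp (l * h)) l 0 := by
      simpa using ((hasDerivAt_id (0 : ℝ)).const_mul l).exp
    have := (hasDerivAt_iff_tendsto_slope.1 hd).mono_left
      (nhdsWithin_mono 0 (fun x (hx : 0 < x) => hx.ne' : Ioi (0 : ℝ) ⊆ {0}ᶜ))
    refine this.congr fun h => ?_
    simp [slope_def_field, div_eq_inv_mul]
  have h2 : Tendsto (fun h : ℝ => Real.exp (l * h)) (𝓝[>] 0) (𝓝 1) := by
    have : Continuous fun t : ℝ => Real.exp (l * t) := by fun_prop
    simpa using (this.tendsto 0).mono_left nhdsWithin_le_nhds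
  have h3 := (h1.smul_const (convB (resK ε l) f)).sub (h2.smul (tendsto_laplace_average hε hl f))
  rw [one_smul] at h3
  refine h3.congr' ?_
  filter_upwards [self_mem_nhdsWithin] with h hh
  rw [heatSemigroup_eq ε hh, convB_assoc, convB_heatK_resK hε hl hh]
  simp only [map_smul, smul_apply, map_sub, sub_apply]
  module

/-- Convolutions commute, so the resolvent applied to the difference quotient of `u` is the
difference quotient of the resolvent of `u`, whose limit is known. -/
theorem IsHeatGenerator.eq_resK (hε : 0 < ε) {l : ℝ} (hl : 0 < l) {u a : L1}
    (h : IsHeatGenerator ε u a) : u = convB (resK ε l) (l • u - a) := by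
  have h1 : Tendsto (fun t : ℝ => convB (resK ε l) (t⁻¹ • (heatSemigroup ε t u - u))) (𝓝[>] 0)
      (𝓝 (convB (resK ε l) a)) := ((convB (resK ε l)).continuous.tendsto a).comp h
  have h2 := isHeatGenerator_resK hε hl u
  have h3 : convB (resK ε l) a = l • convB (resK ε l) u - u := by
    refine tendsto_nhds_unique h1 (h2.congr' ?_)
    filter_upwards [self_mem_nhdsWithin] with t ht
    rw [heatSemigroup_eq ε ht, heatSemigroup_eq ε ht, map_smul, map_sub, convB_assoc, convB_assoc,
      convB_comm (heatK ε t)]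
  rw [map_sub, map_smul, h3]
  abel

/-- The closure of the range contains the difference quotients of each resolvent value, hence their
limit `l R f - f`, hence `f`. -/
theorem denseRange_resK (hε : 0 < ε) {l : ℝ} (hl : 0 < l) : DenseRange (convB (resK ε l)) := by
  intro f
  set S := (LinearMap.range (convB (resK ε l)).toLinearMap).topologicalClosure with hS
  have hmem : ∀ g, convB (resK ε l) g ∈ S := fun g =>
    Submodule.le_topologicalClosure _ ⟨g, rfl⟩
  have h1 : l • convB (resK ε l) f - f ∈ S := by
    refine (Submodule.isClosed_topologicalClosure _).mem_of_tendsto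
      (isHeatGenerator_resK hε hl f) ?_
    filter_upwards [self_mem_nhdsWithin] with t ht
    rw [heatSemigroup_eq ε ht, convB_assoc, convB_comm (heatK ε t), ← convB_assoc]
    exact S.smul_mem _ (S.sub_mem (hmem _) (hmem _))
  have h2 : f ∈ S := by
    have := S.sub_mem (S.smul_mem l (hmem f)) h1
    simpa using this
  exact h2

theorem heatDomain_subset_W11 (hε : 0 < ε) : heatDomain ε ⊆ W11 := by
  rintro u ⟨a, ha⟩ i
  have h := isWeakPartial_resK hε i zero_lt_one ((1 : ℝ) • u - a)
  rw [← ha.eq_resK hε zero_lt_one] at h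
  exact ⟨_, h⟩

end Laplace

/-! ### Mollification in `W^{1,1}`. -/

section Mollify

theorem IsWeakPartial.fderiv_convFn {i : Fin 2} {u g : L1} (h : IsWeakPartial i u g)
    {k : Plane → ℝ} (hk : ContDiff ℝ ∞ k) (hc : HasCompactSupport k) (x : Plane) :
    fderiv ℝ (convFn k u) x (e i) = convFn k g x := by
  have hu : LocallyIntegrable (u : Plane → ℝ) volume := (L1.integrable_coeFn u).locallyIntegrable
  have h1 := hc.hasFDerivAt_convolution_right (ContinuousLinearMap.mul ℝ ℝ) hu
    (hk.of_le (by simp)) x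
  rw [convFn, h1.fderiv, convolution_precompR_apply _ hu (hc.fderiv ℝ)
    (hk.continuous_fderiv (by simp))]
  have hψ : ContDiff ℝ ∞ fun z => k (x - z) := hk.comp (contDiff_const.sub contDiff_id)
  have hψc : HasCompactSupport fun z => k (x - z) := by
    have := hc.comp_homeomorph (Homeomorph.subLeft x)
    exact this
  have hd : ∀ z, fderiv ℝ (fun z => k (x - z)) z (e i) = -fderiv ℝ k (x - z) (e i) := fun z => by
    have h2 : HasFDerivAt (fun z => k (x - z))
        ((fderiv ℝ k (x - z)).comp (-ContinuousLinearMap.id ℝ Plane)) z :=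
      HasFDerivAt.comp (g := k) z (hk.differentiable (by simp) (x - z)).hasFDerivAt
        ((hasFDerivAt_id z).const_sub x)
    rw [h2.fderiv]
    simp
  have h3 := h _ hψ hψc
  simp only [hd, mul_neg, integral_neg, neg_inj] at h3
  exact h3

/-- A single kernel serves `u` and both components of its gradient: a bump supported within the
smallest of the three radii has no mass beyond any of them. -/
theorem exists_mollifier (u : L1) (g : Fin 2 → L1) {η : ℝ} (hη : 0 < η) :
    ∃ (k : Plane → ℝ) (hk : Integrable k), ContDiff ℝ ∞ k ∧ HasCompactSupport k ∧
      ‖convB (hk.toL1 k) u - u‖ ≤ η ∧ ∀ i, ‖convB (hk.toL1 k) (g i) - g i‖ ≤ η := by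
  obtain ⟨δ, hδ, H⟩ := exists_norm_convB_sub_le u hη
  obtain ⟨δ₀, hδ₀, H₀⟩ := exists_norm_convB_sub_le (g 0) hη
  obtain ⟨δ₁, hδ₁, H₁⟩ := exists_norm_convB_sub_le (g 1) hη
  set d := min δ (min δ₀ δ₁) with hd
  have hd0 : 0 < d := by positivity
  let b : ContDiffBump (0 : Plane) := ⟨d / 2, d, half_pos hd0, half_lt_self hd0⟩
  have hk : Integrable (b.normed volume) := b.integrable_normed
  have htail : ∀ r, d ≤ r → ∫ y in {y : Plane | r < ‖y‖}, b.normed volume y = 0 := by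
    intro r hr
    have hm : MeasurableSet {y : Plane | r < ‖y‖} :=
      (isOpen_lt continuous_const continuous_norm).measurableSet
    refine setIntegral_eq_zero_of_forall_eq_zero fun y hy => ?_
    by_contra hne
    have hs : y ∈ Function.support (b.normed volume) := hne
    rw [b.support_normed_eq, mem_ball_zero_iff] at hs
    have hy' : r < ‖y‖ := hy
    have hs' : ‖y‖ < d := hs
    linarith
  refine ⟨b.normed volume, hk, b.contDiff_normed, b.hasCompactSupport_normed,
    H _ hk b.nonneg_normed b.integral_normed ((htail δ (min_le_left _ _)).trans_le hδ.le),
    fun i => ?_⟩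
  fin_cases i
  · exact H₀ _ hk b.nonneg_normed b.integral_normed
      ((htail δ₀ ((min_le_right _ _).trans (min_le_left _ _))).trans_le hδ₀.le)
  · exact H₁ _ hk b.nonneg_normed b.integral_normed
      ((htail δ₁ ((min_le_right _ _).trans (min_le_right _ _))).trans_le hδ₁.le)

end Mollify

/-! ### The transport operators `u ↦ u(x - hC(x))` and their derivative at `h = 0`. -/

section Transport

/-- Lebesgue measure is a multiple of the two-dimensional Hausdorff measure, and preimages under a
`K`-antilipschitz map enlarge the latter by at most `K²`. No Jacobian is involved. -/
theorem mapBound_of_antilipschitzWith {Φ : Plane → Plane} (hm : Measurable Φ) {K : NNReal}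
    (hK : AntilipschitzWith K Φ) : MapBound Φ ((K : ℝ) ^ 2) := by
  refine ⟨hm, sq_nonneg _, Measure.le_iff.2 fun S hS => ?_⟩
  have hfin : Module.finrank ℝ Plane = 2 := by simp
  have : (Measure.hausdorffMeasure (2 : ℝ) : Measure Plane).IsAddHaarMeasure := by
    have := isAddHaarMeasure_hausdorffMeasure (E := Plane)
    rw [hfin] at this
    exact_mod_cast this
  rw [Measure.map_apply hm hS, Measure.smul_apply, smul_eq_mul,
    Measure.isAddLeftInvariant_eq_smul (volume : Measure Plane) (Measure.hausdorffMeasure (2 : ℝ))]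
  simp only [Measure.smul_apply, ENNReal.smul_def, smul_eq_mul]
  rw [mul_left_comm]
  gcongr
  refine (hK.hausdorffMeasure_preimage_le zero_le_two S).trans (le_of_eq ?_)
  rw [ENNReal.ofReal_pow K.coe_nonneg, ENNReal.ofReal_coe_nnreal]
  congr 1
  exact ENNReal.rpow_natCast _ 2

variable {C : Plane → Plane} {L : NNReal} {M : ℝ}

/-- The map is antilipschitz with constant `(1 - hL)⁻¹`, and `(1 - y)⁻² ≤ 1 + 4y` for `0 ≤ y ≤ 1/4`.
Only the first-order growth in `h` matters for dissipativity. -/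
theorem mapBound_transport (hC : LipschitzWith L C) {h : ℝ} (h0 : 0 ≤ h) (hL : 4 * (h * L) ≤ 1) :
    MapBound (fun x => x - h • C x) (1 + 4 * (h * L)) := by
  set y : ℝ := h * L with hy
  have hy0 : 0 ≤ y := by positivity
  have hy1 : 0 < 1 - y := by linarith
  have hm : Measurable fun x => x - h • C x :=
    (continuous_id.sub (hC.continuous.const_smul h)).measurable
  have ha : AntilipschitzWith (Real.toNNReal (1 - y)⁻¹) fun x => x - h • C x := by
    refine AntilipschitzWith.of_le_mul_dist fun a b => ?_
    rw [Real.coe_toNNReal _ (by positivity), inv_mul_eq_div, le_div_iff₀ hy1]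
    have h1 := hC.dist_le_mul a b
    rw [dist_eq_norm] at h1 ⊢
    rw [dist_eq_norm]
    have h2 : a - h • C a - (b - h • C b) = (a - b) - h • (C a - C b) := by module
    rw [h2]
    have h3 := norm_sub_norm_le (a - b) (h • (C a - C b))
    rw [norm_smul, Real.norm_of_nonneg h0] at h3
    rw [dist_eq_norm] at h1
    nlinarith [mul_le_mul_of_nonneg_left h1 h0]
  refine (mapBound_of_antilipschitzWith hm ha).mono ?_
  rw [Real.coe_toNNReal _ (by positivity), inv_pow, inv_le_iff_one_le_mul₀ (by positivity)]
  nlinarith [mul_nonneg hy0 (by linarith : 0 ≤ 1 - 4 * y), mul_nonneg hy0 hy0]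

theorem apply_eq_sum (A : Plane →L[ℝ] ℝ) (v : Plane) : A v = ∑ i, v i * A (e i) := by
  have hv : v = ∑ i, v i • e i := by
    ext j
    fin_cases j <;> simp [e]
  conv_lhs => rw [hv]
  simp

/-- The fundamental theorem of calculus along the segment `s ↦ x - s C(x)`. -/
theorem abs_transport_difference_le {w : Plane → ℝ} (hw : ContDiff ℝ 1 w)
    (hM : ∀ x i, |C x i| ≤ M) {h : ℝ} (h0 : 0 < h) (x : Plane) :
    |h⁻¹ * (w (x - h • C x) - w x) + ∑ i, C x i * fderiv ℝ w x (e i)|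
      ≤ h⁻¹ * M * ∑ i, ∫ s in (0 : ℝ)..h,
          |fderiv ℝ w (x - s • C x) (e i) - fderiv ℝ w x (e i)| := by
  have hdc : ∀ i, Continuous fun y => fderiv ℝ w y (e i) := fun i =>
    (hw.continuous_fderiv (by simp)).clm_apply continuous_const
  have hsc : ∀ i, Continuous fun s : ℝ => fderiv ℝ w (x - s • C x) (e i) := fun i =>
    (hdc i).comp (by fun_prop)
  have hd : ∀ s : ℝ, HasDerivAt (fun s : ℝ => w (x - s • C x))
      (-∑ i, C x i * fderiv ℝ w (x - s • C x) (e i)) s := by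
    intro s
    have h1 : HasDerivAt (fun s : ℝ => x - s • C x) (-C x) s := by
      simpa using ((hasDerivAt_id s).smul_const (C x)).const_sub x
    have h2 := (hw.differentiable (by simp) (x - s • C x)).hasFDerivAt.comp_hasDerivAt s h1
    rwa [map_neg, apply_eq_sum] at h2
  have hi : ∀ i, IntervalIntegrable (fun s : ℝ =>
      fderiv ℝ w (x - s • C x) (e i) - fderiv ℝ w x (e i)) volume 0 h := fun i =>
    ((hsc i).sub continuous_const).intervalIntegrable _ _
  have hftc := intervalIntegral.integral_eq_sub_of_hasDerivAt (a := 0) (b := h)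
    (fun s _ => hd s) ((continuous_finsetSum _ fun i _ =>
      (hsc i).const_mul (C x i)).neg.intervalIntegrable _ _)
  have key : h⁻¹ * (w (x - h • C x) - w x) + ∑ i, C x i * fderiv ℝ w x (e i)
      = ∑ i, -(h⁻¹ * C x i *
        ∫ s in (0 : ℝ)..h, (fderiv ℝ w (x - s • C x) (e i) - fderiv ℝ w x (e i))) := by
    have e1 : ∀ i, ∫ s in (0 : ℝ)..h, (fderiv ℝ w (x - s • C x) (e i) - fderiv ℝ w x (e i))
        = (∫ s in (0 : ℝ)..h, fderiv ℝ w (x - s • C x) (e i)) - h * fderiv ℝ w x (e i) := by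
      intro i
      rw [intervalIntegral.integral_sub ((hsc i).intervalIntegrable _ _) intervalIntegrable_const]
      simp
    simp only [zero_smul, sub_zero] at hftc
    rw [← hftc, intervalIntegral.integral_neg, intervalIntegral.integral_finsetSum
      fun i _ => ((hsc i).const_mul (C x i)).intervalIntegrable _ _]
    simp only [intervalIntegral.integral_const_mul, e1, Fin.sum_univ_two]
    field_simp
    ring
  rw [key, Finset.mul_sum]
  refine (Finset.abs_sum_le_sum_abs _ _).trans (Finset.sum_le_sum fun i _ => ?_)
  rw [abs_neg, abs_mul, abs_mul, abs_of_pos (inv_pos.2 h0)]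
  have h3 : |∫ s in (0 : ℝ)..h, (fderiv ℝ w (x - s • C x) (e i) - fderiv ℝ w x (e i))|
      ≤ ∫ s in (0 : ℝ)..h, |fderiv ℝ w (x - s • C x) (e i) - fderiv ℝ w x (e i)| :=
    intervalIntegral.abs_integral_le_integral_abs h0.le
  have h4 : 0 ≤ M := (abs_nonneg _).trans (hM x i)
  gcongr
  exact hM x i

theorem integral_transport_difference_le (hC : LipschitzWith L C) (hM : ∀ x i, |C x i| ≤ M)
    {w : Plane → ℝ} (hw : ContDiff ℝ 1 w) (hwi : ∀ i, Integrable fun x => fderiv ℝ w x (e i))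
    {h η : ℝ} (h0 : 0 < h) (hL : 4 * (h * L) ≤ 1)
    (hη : ∀ i, ∀ s ∈ Ioc 0 h,
      ∫ x, |fderiv ℝ w (x - s • C x) (e i) - fderiv ℝ w x (e i)| ≤ η) :
    ∫ x, |h⁻¹ * (w (x - h • C x) - w x) + ∑ i, C x i * fderiv ℝ w x (e i)| ≤ 2 * M * η := by
  have hM0 : 0 ≤ M := (abs_nonneg _).trans (hM 0 0)
  set D : Fin 2 → Plane × ℝ → ℝ := fun i p =>
    |fderiv ℝ w (p.1 - p.2 • C p.1) (e i) - fderiv ℝ w p.1 (e i)| with hD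
  have hdc : ∀ i, Continuous fun y => fderiv ℝ w y (e i) := fun i =>
    (hw.continuous_fderiv (by simp)).clm_apply continuous_const
  have hDc : ∀ i, Continuous (D i) := fun i => by
    have h1 : Continuous fun p : Plane × ℝ => p.1 - p.2 • C p.1 :=
      continuous_fst.sub (continuous_snd.smul (hC.continuous.comp continuous_fst))
    exact (((hdc i).comp h1).sub ((hdc i).comp continuous_fst)).abs
  have hsl : ∀ i, ∀ s ∈ Ioc 0 h, Integrable fun x => D i (x, s) := fun i s hs => by
    have hmb := mapBound_transport hC hs.1.le (h := s)
      (le_trans (by gcongr; exact hs.2) hL)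
    exact ((hmb.integrable_comp (hwi i)).sub (hwi i)).abs
  have hDi : ∀ i, Integrable (D i) (volume.prod (volume.restrict (Ioc 0 h))) := fun i => by
    have hmeas := (hDc i).aestronglyMeasurable (μ := (volume : Measure Plane).prod
      ((volume : Measure ℝ).restrict (Ioc 0 h)))
    rw [integrable_prod_iff' hmeas]
    refine ⟨(ae_restrict_mem measurableSet_Ioc).mono fun s hs => hsl i s hs, ?_⟩
    refine Integrable.mono' (integrable_const η)
      hmeas.norm.prod_swap.integral_prod_right' ?_
    refine (ae_restrict_mem measurableSet_Ioc).mono fun s hs => ?_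
    rw [Real.norm_of_nonneg (integral_nonneg fun x => norm_nonneg _)]
    refine le_trans (le_of_eq ?_) (hη i s hs)
    refine integral_congr_ae (Eventually.of_forall fun x => ?_)
    simp [hD]
  have hint : ∀ i, Integrable fun x => ∫ s in (0 : ℝ)..h, D i (x, s) := fun i => by
    simp only [intervalIntegral.integral_of_le h0.le]
    exact (hDi i).integral_prod_left
  have hval : ∀ i, ∫ x, ∫ s in (0 : ℝ)..h, D i (x, s) ≤ h * η := fun i => by
    simp only [intervalIntegral.integral_of_le h0.le]
    rw [integral_integral_swap (f := fun x s => D i (x, s)) (hDi i)]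
    calc ∫ s in Ioc 0 h, ∫ x, D i (x, s) ≤ ∫ s in Ioc 0 h, η :=
          setIntegral_mono_on (hDi i).integral_prod_right (integrable_const η) measurableSet_Ioc
            fun s hs => hη i s hs
      _ = h * η := by simp [h0.le]
  calc _ ≤ ∫ x, h⁻¹ * M * ∑ i, ∫ s in (0 : ℝ)..h, D i (x, s) :=
        integral_mono_of_nonneg (Eventually.of_forall fun x => abs_nonneg _)
          ((integrable_finsetSum _ fun i _ => hint i).const_mul _)
          (Eventually.of_forall fun x => abs_transport_difference_le hw hM h0 x)
    _ = h⁻¹ * M * ∑ i, ∫ x, ∫ s in (0 : ℝ)..h, D i (x, s) := by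
        rw [integral_const_mul, integral_finsetSum _ fun i _ => hint i]
    _ ≤ h⁻¹ * M * ∑ _i : Fin 2, h * η := by
        gcongr with i
        exact hval i
    _ = 2 * M * η := by
        simp only [Fin.sum_univ_two]
        field_simp
        ring

/-- The operator `u ↦ C · g`, where `g` is the gradient of `u`. -/
def driftL (C : Plane → Plane) (hC : Continuous C) (hM : ∀ x i, |C x i| ≤ M) (g : Fin 2 → L1) :
    L1 :=
  ∑ i, mulL (fun x => C x i) (by fun_prop) M (fun x => hM x i) (g i)

theorem norm_driftL_sub_le (hC : Continuous C) (hM : ∀ x i, |C x i| ≤ M) (g g' : Fin 2 → L1) :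
    ‖driftL C hC hM g - driftL C hC hM g'‖ ≤ M * ∑ i, ‖g i - g' i‖ := by
  rw [driftL, driftL, ← Finset.sum_sub_distrib, Finset.mul_sum]
  refine norm_sum_le_of_le _ fun i _ => ?_
  rw [← map_sub]
  exact norm_mulL_le _ _ _

theorem coeFn_driftL (hC : Continuous C) (hM : ∀ x i, |C x i| ≤ M) (g : Fin 2 → L1) :
    driftL C hC hM g =ᵐ[volume] fun x => ∑ i, C x i * g i x := by
  rw [driftL, Fin.sum_univ_two]
  filter_upwards [Lp.coeFn_add (mulL (fun x => C x 0) (by fun_prop) M (fun x => hM x 0) (g 0))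
      (mulL (fun x => C x 1) (by fun_prop) M (fun x => hM x 1) (g 1)),
    coeFn_mulL (ψ := fun x => C x 0) (by fun_prop) (fun x => hM x 0) (g 0),
    coeFn_mulL (ψ := fun x => C x 1) (by fun_prop) (fun x => hM x 1) (g 1)] with x h1 h2 h3
  rw [h1, Pi.add_apply, h2, h3, Fin.sum_univ_two]

theorem norm_transport_difference_smooth_le (hC : LipschitzWith L C) (hM : ∀ x i, |C x i| ≤ M)
    {u : L1} {g : Fin 2 → L1} {w : Plane → ℝ} (hw : ContDiff ℝ 1 w) (hu : u =ᵐ[volume] w)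
    (hg : ∀ i, g i =ᵐ[volume] fun x => fderiv ℝ w x (e i))
    {h η : ℝ} (h0 : 0 < h) (hL : 4 * (h * L) ≤ 1)
    (hη : ∀ i, ∀ s ∈ Ioc 0 h, ∀ c (H : MapBound (fun x => x - s • C x) c),
      ‖H.compL (g i) - g i‖ ≤ η) {c : ℝ} (H : MapBound (fun x => x - h • C x) c) :
    ‖h⁻¹ • (H.compL u - u) + driftL C hC.continuous hM g‖ ≤ 2 * M * η := by
  refine le_trans (le_of_eq ?_) (integral_transport_difference_le hC hM hw
    (fun i => (L1.integrable_coeFn (g i)).congr (hg i)) h0 hL fun i s hs => ?_)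
  · rw [L1.norm_eq_integral_norm]
    refine integral_congr_ae ?_
    filter_upwards [Lp.coeFn_add (h⁻¹ • (H.compL u - u)) (driftL C hC.continuous hM g),
      Lp.coeFn_smul h⁻¹ (H.compL u - u), Lp.coeFn_sub (H.compL u) u, H.coeFn_compL u,
      H.quasi.ae hu, hu, coeFn_driftL hC.continuous hM g, ae_all_iff.2 hg]
      with x h1 h2 h3 h4 h5 h6 h7 h8
    rw [h1, Pi.add_apply, h2, Pi.smul_apply, h3, Pi.sub_apply, h4, h5, h6, h7, Real.norm_eq_abs,
      smul_eq_mul]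
    simp only [h8]
  · have Hs := mapBound_transport hC hs.1.le (h := s) (le_trans (by gcongr; exact hs.2) hL)
    refine le_trans (le_of_eq ?_) (hη i s hs _ Hs)
    rw [L1.norm_eq_integral_norm]
    refine integral_congr_ae ?_
    filter_upwards [Lp.coeFn_sub (Hs.compL (g i)) (g i), Hs.coeFn_compL (g i), hg i,
      Hs.quasi.ae (hg i)] with x h1 h2 h3 h4
    rw [h1, Pi.sub_apply, h2, h3, h4, Real.norm_eq_abs]

/-- The smooth estimate involves only the gradient and the transport operators, so it survives
approximation by mollified functions, whose gradients are the mollified weak gradients. -/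
theorem norm_transport_difference_le (hC : LipschitzWith L C) (hM : ∀ x i, |C x i| ≤ M)
    {u : L1} {g : Fin 2 → L1} (hg : ∀ i, IsWeakPartial i u (g i))
    {h η : ℝ} (h0 : 0 < h) (hL : 4 * (h * L) ≤ 1)
    (hη : ∀ i, ∀ s ∈ Ioc 0 h, ∀ c (H : MapBound (fun x => x - s • C x) c),
      ‖H.compL (g i) - g i‖ ≤ η) {c : ℝ} (H : MapBound (fun x => x - h • C x) c) :
    ‖h⁻¹ • (H.compL u - u) + driftL C hC.continuous hM g‖ ≤ 2 * M * η := by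
  have hM0 : 0 ≤ M := (abs_nonneg _).trans (hM 0 0)
  have H2 : ∀ s ∈ Ioc 0 h, MapBound (fun x => x - s • C x) 2 := fun s hs =>
    (mapBound_transport hC hs.1.le (le_trans (by gcongr; exact hs.2) hL)).mono (by
      have : s * L ≤ h * L := by gcongr; exact hs.2
      linarith)
  have hbound : ∀ δ > 0, ‖h⁻¹ • (H.compL u - u) + driftL C hC.continuous hM g‖
      ≤ 2 * M * (η + 3 * δ) + (h⁻¹ * (3 * δ) + M * (2 * δ)) := by
    intro δ hδ
    obtain ⟨k, hk, hks, hkc, hku, hkg⟩ := exists_mollifier u g hδ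
    set u' := convB (hk.toL1 k) u
    set g' : Fin 2 → L1 := fun i => convB (hk.toL1 k) (g i)
    have hw : ContDiff ℝ 1 (convFn k u) :=
      hkc.contDiff_convolution_right _ (L1.integrable_coeFn u).locallyIntegrable
        (hks.of_le (by simp))
    have h1 := norm_transport_difference_smooth_le hC hM (u := u') (g := g') hw
      (coeFn_convB_toL1 hk u)
      (fun i => (coeFn_convB_toL1 hk (g i)).trans (Eventually.of_forall fun x =>
        ((hg i).fderiv_convFn hks hkc x).symm)) (η := η + 3 * δ) h0 hL
      (fun i s hs c' H' => by
        have e1 : H'.compL (g' i) - g' i = H'.compL (g i) - g i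
            + (H'.compL (g' i - g i) - (g' i - g i)) := by rw [map_sub]; abel
        -- The composition operator does not depend on the constant `c'` of `H'`, so the bound with
        -- constant `2` applies to it.
        have e2 : ‖H'.compL (g' i - g i)‖ ≤ 2 * ‖g' i - g i‖ :=
          (H2 s hs).norm_compL_le (g' i - g i)
        rw [e1]
        refine (norm_add_le _ _).trans (add_le_add (hη i s hs c' H') ((norm_sub_le _ _).trans ?_))
        linarith [hkg i]) H
    have e3 : h⁻¹ • (H.compL u - u) + driftL C hC.continuous hM g
        = (h⁻¹ • (H.compL u' - u') + driftL C hC.continuous hM g')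
          - (h⁻¹ • (H.compL (u' - u) - (u' - u))
            + (driftL C hC.continuous hM g' - driftL C hC.continuous hM g)) := by
      rw [map_sub]; module
    rw [e3]
    refine (norm_sub_le _ _).trans (add_le_add h1 ((norm_add_le _ _).trans (add_le_add ?_ ?_)))
    · rw [norm_smul, Real.norm_of_nonneg (inv_pos.2 h0).le]
      gcongr
      refine (norm_sub_le _ _).trans ?_
      have : ‖H.compL (u' - u)‖ ≤ 2 * ‖u' - u‖ := (H2 h ⟨h0, le_rfl⟩).norm_compL_le (u' - u)
      linarith
    · refine (norm_driftL_sub_le hC.continuous hM g' g).trans ?_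
      gcongr
      rw [Fin.sum_univ_two]
      linarith [hkg 0, hkg 1]
  have hlim : Tendsto (fun δ : ℝ => 2 * M * (η + 3 * δ) + (h⁻¹ * (3 * δ) + M * (2 * δ)))
      (𝓝[>] 0) (𝓝 (2 * M * η)) := by
    have hc : Continuous fun δ : ℝ => 2 * M * (η + 3 * δ) + (h⁻¹ * (3 * δ) + M * (2 * δ)) := by
      fun_prop
    simpa using (hc.tendsto 0).mono_left nhdsWithin_le_nhds
  refine ge_of_tendsto hlim ?_
  filter_upwards [self_mem_nhdsWithin] with δ hδ
  exact hbound δ hδ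

/-- The derivative at `h = 0` of the transport operators `u ↦ u(x - h C(x))` on `W^{1,1}`. -/
theorem exists_norm_transport_difference_le (hC : LipschitzWith L C) (hM : ∀ x i, |C x i| ≤ M)
    {B : ℝ} (hB : ∀ x, ‖C x‖ ≤ B) {u : L1} {g : Fin 2 → L1} (hg : ∀ i, IsWeakPartial i u (g i))
    {η : ℝ} (hη : 0 < η) :
    ∃ h₀ : ℝ, 0 < h₀ ∧ ∀ h : ℝ, 0 < h → h ≤ h₀ → ∀ c (H : MapBound (fun x => x - h • C x) c),
      ‖h⁻¹ • (H.compL u - u) + driftL C hC.continuous hM g‖ ≤ η := by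
  have hM0 : 0 ≤ M := (abs_nonneg _).trans (hM 0 0)
  have hB0 : 0 ≤ B := (norm_nonneg _).trans (hB 0)
  have hη' : 0 < η / (2 * M + 1) := by positivity
  obtain ⟨δ₀, hδ₀, H₀⟩ := exists_integral_comp_sub_le (L1.integrable_coeFn (g 0)) hη'
  obtain ⟨δ₁, hδ₁, H₁⟩ := exists_integral_comp_sub_le (L1.integrable_coeFn (g 1)) hη'
  have hnorm : ∀ (s c : ℝ) (H : MapBound (fun x => x - s • C x) c) (v : L1),
      ‖H.compL v - v‖ = ∫ x, |v (x - s • C x) - v x| := fun s c H v => by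
    rw [L1.norm_eq_integral_norm]
    refine integral_congr_ae ?_
    filter_upwards [Lp.coeFn_sub (H.compL v) v, H.coeFn_compL v] with x h1 h2
    rw [h1, Pi.sub_apply, h2, Real.norm_eq_abs]
  -- The first two terms keep the displacement `s‖C(x)‖` below `δ₀` and `δ₁`; the third ensures `4hL
  -- ≤ 1`.
  set h₀ := min (min (δ₀ / (B + 1)) (δ₁ / (B + 1))) (1 / (4 * ((L : ℝ) + 1))) with hh₀
  refine ⟨h₀, by positivity, fun h h0 hh c H => ?_⟩
  have hL : 4 * (h * L) ≤ 1 := by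
    have h1 : h ≤ 1 / (4 * ((L : ℝ) + 1)) := hh.trans (min_le_right _ _)
    rw [le_div_iff₀ (by positivity)] at h1
    nlinarith
  have h2 : ∀ s ∈ Ioc 0 h, MapBound (fun x => x - s • C x) 2 := fun s hs =>
    (mapBound_transport hC hs.1.le (le_trans (by gcongr; exact hs.2) hL)).mono (by
      have : s * L ≤ h * L := by gcongr; exact hs.2
      linarith)
  have hdist : ∀ δ, h₀ ≤ δ / (B + 1) → ∀ s ∈ Ioc 0 h, ∀ x, dist (x - s • C x) x ≤ δ := by
    intro δ hδ s hs x
    rw [dist_eq_norm, sub_sub_cancel_left, norm_neg, norm_smul, Real.norm_of_nonneg hs.1.le]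
    have h3 : s ≤ δ / (B + 1) := hs.2.trans (hh.trans hδ)
    rw [le_div_iff₀ (by positivity)] at h3
    have := mul_le_mul_of_nonneg_left (hB x) hs.1.le
    nlinarith [hs.1]
  refine (norm_transport_difference_le hC hM hg h0 hL (η := η / (2 * M + 1))
    (fun i s hs c' H' => ?_) H).trans ?_
  · rw [hnorm]
    fin_cases i
    · exact H₀ _ (h2 s hs) (hdist δ₀ ((min_le_left _ _).trans (min_le_left _ _)) s hs)
    · exact H₁ _ (h2 s hs) (hdist δ₁ ((min_le_left _ _).trans (min_le_right _ _)) s hs)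
  · rw [mul_div_assoc', div_le_iff₀ (by positivity)]
    nlinarith

end Transport

/-! ### Dissipativity for the norm and for the negative part. -/

section Dissipativity

/-- The properties shared by `u ↦ ‖u‖` and `u ↦ ‖u⁻‖` which make convection-diffusion operators
dissipative. -/
structure IsContractivityGauge (q : L1 → ℝ) : Prop where
  add_le : ∀ u v, q (u + v) ≤ q u + q v
  smul : ∀ r : ℝ, 0 ≤ r → ∀ u, q (r • u) = r * q u
  le_norm : ∀ u, q u ≤ ‖u‖
  map_le : ∀ (T : L1 →L[ℝ] L1) (c : ℝ), (∀ u, 0 ≤ u → 0 ≤ T u) → (∀ u, ‖T u‖ ≤ c * ‖u‖) →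
    ∀ u, q (T u) ≤ c * q u

theorem isContractivityGauge_norm : IsContractivityGauge fun u => ‖u‖ where
  add_le := norm_add_le
  smul r hr u := by rw [norm_smul, Real.norm_of_nonneg hr]
  le_norm _ := le_rfl
  map_le _ _ _ hc := hc

theorem negPart_smul_of_nonneg {r : ℝ} (hr : 0 ≤ r) (u : L1) : (r • u)⁻ = r • u⁻ := by
  apply Lp.ext
  filter_upwards [Lp.coeFn_sup (-(r • u)) 0, Lp.coeFn_neg (r • u), Lp.coeFn_smul r u,
    Lp.coeFn_smul r u⁻, Lp.coeFn_sup (-u) 0, Lp.coeFn_neg u,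
    Lp.coeFn_zero ℝ 1 (volume : Measure Plane)]
    with x h1 h2 h3 h4 h5 h6 h7
  rw [h4, Pi.smul_apply, negPart_def, negPart_def, h1, h5, Pi.sup_apply, Pi.sup_apply, h2, h6, h7,
    Pi.neg_apply, Pi.neg_apply, h3, Pi.smul_apply, smul_eq_mul, smul_eq_mul, Pi.zero_apply,
    mul_max_of_nonneg _ _ hr, mul_neg, mul_zero]

theorem isContractivityGauge_negPart : IsContractivityGauge fun u => ‖u⁻‖ where
  add_le := norm_negPart_add_le
  smul r hr u := by rw [negPart_smul_of_nonneg hr, norm_smul, Real.norm_of_nonneg hr]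
  le_norm := norm_negPart_le
  map_le _ _ hT hc := negPart_map_le hT hc

variable {ε : ℝ} {C : Plane → Plane} {χ : Plane → ℝ} {L : NNReal} {M m : ℝ}

/-- Dissipativity of the operator `A - C·∇ + χ` in `L¹`. -/
theorem IsContractivityGauge.dissipative {q : L1 → ℝ} (hq : IsContractivityGauge q) (hε : 0 < ε)
    (hC : LipschitzWith L C) (hM : ∀ x, ‖C x‖ ≤ M) (hMi : ∀ x i, |C x i| ≤ M)
    (hχ : Continuous χ) (hm : ∀ x, |χ x| ≤ m) {u a f : L1} {g : Fin 2 → L1} {l : ℝ} (hl : 0 ≤ l)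
    (ha : IsHeatGenerator ε u a) (hg : ∀ i, IsWeakPartial i u (g i))
    (hf : a - driftL C hC.continuous hMi g + mulL χ hχ m hm u = l • u - f) :
    (l - (4 * L + m)) * q u ≤ q f := by
  have hm0 : 0 ≤ m := (abs_nonneg _).trans (hm 0)
  refine le_of_forall_pos_le_add fun η hη => ?_
  obtain ⟨h₀, hh₀, htr⟩ := exists_norm_transport_difference_le hC hMi hM hg (half_pos hη)
  have hgen := (tendsto_iff_norm_sub_tendsto_zero.1 ha).eventually (gt_mem_nhds (half_pos hη))
  have hsmall : ∀ᶠ h : ℝ in 𝓝[>] 0, h ≤ min h₀ (1 / (4 * ((L : ℝ) + 1))) :=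
    nhdsWithin_le_nhds (Iic_mem_nhds (by positivity))
  obtain ⟨h, hgen, hsm, hh⟩ := (hgen.and (hsmall.and self_mem_nhdsWithin)).exists
  have h0 : 0 < h := hh
  have hL : 4 * (h * L) ≤ 1 := by
    have h1 : h ≤ 1 / (4 * ((L : ℝ) + 1)) := hsm.trans (min_le_right _ _)
    rw [le_div_iff₀ (by positivity)] at h1
    nlinarith
  have H := mapBound_transport hC h0.le hL
  have htr := htr h h0 (hsm.trans (min_le_left _ _)) _ H
  rw [heatSemigroup_eq ε h0] at hgen
  -- The remainder `r` below collects the errors of the two difference quotients, for the diffusion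
  -- and for the drift.
  set T := convB (heatK ε h)
  set r : L1 := -(h⁻¹ • (T u - u) - a) - (h⁻¹ • (H.compL u - u) + driftL C hC.continuous hMi g)
    with hr
  have hrn : ‖r‖ ≤ η := by
    refine (norm_sub_le _ _).trans ?_
    rw [norm_neg]
    linarith
  have hm2 : ∀ x, |χ x + m| ≤ 2 * m := fun x => by
    have := abs_le.1 (hm x)
    rw [abs_le]
    constructor <;> linarith
  -- Since `χ` may be negative, it is shifted by `m` so that multiplication becomes a positive
  -- operator, as `map_le` requires.
  have hχm : Continuous fun x => χ x + m := by fun_prop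
  set Q := mulL (fun x => χ x + m) hχm (2 * m) hm2
  have hQ : Q u = mulL χ hχ m hm u + m • u := by
    apply Lp.ext
    filter_upwards [coeFn_mulL hχm hm2 u, Lp.coeFn_add (mulL χ hχ m hm u) (m • u),
      coeFn_mulL hχ hm u, Lp.coeFn_smul m u] with x h1 h2 h3 h4
    rw [h1, h2, Pi.add_apply, h3, h4, Pi.smul_apply, smul_eq_mul, add_mul]
  -- The equation for `u` multiplied by `h`, with both difference quotients cleared; every
  -- coefficient is nonnegative. Under `q` the terms of order `0` in `h` cancel, and division by `h`
  -- leaves the claim up to `η`.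
  have key : (2 + h * (l + m)) • u = T u + H.compL u + h • (Q u + (f + r)) := by
    have hf' : f = l • u - (a - driftL C hC.continuous hMi g + mulL χ hχ m hm u) := by
      rw [hf]; abel
    rw [hQ, hf', hr]
    simp only [smul_add, smul_sub, smul_neg, smul_smul, mul_inv_cancel₀ h0.ne']
    module
  have e1 : q (T u) ≤ 1 * q u := hq.map_le T 1 (fun v hv => convB_nonneg (heatK_nonneg ε h0) hv)
    (fun v => (norm_convB_le _ v).trans (by rw [norm_heatK hε h0])) u
  have e2 : q (H.compL u) ≤ (1 + 4 * (h * L)) * q u :=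
    hq.map_le _ _ (fun v hv => H.compL_nonneg hv) H.norm_compL_le u
  have e3 : q (Q u) ≤ 2 * m * q u :=
    hq.map_le _ _ (fun v hv => mulL_nonneg hχm hm2 (fun x => by linarith [(abs_le.1 (hm x)).1]) hv)
      (norm_mulL_le hχm hm2) u
  have e4 : (2 + h * (l + m)) * q u ≤ q u + (1 + 4 * (h * L)) * q u
      + h * (2 * m * q u + (q f + η)) := by
    rw [← hq.smul _ (by positivity), key]
    refine (hq.add_le _ _).trans (add_le_add
      ((hq.add_le _ _).trans (add_le_add (by simpa using e1) e2)) ?_)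
    rw [hq.smul _ h0.le]
    gcongr
    refine (hq.add_le _ _).trans (add_le_add e3 ((hq.add_le _ _).trans ?_))
    gcongr
    exact (hq.le_norm r).trans hrn
  have e5 : h * ((l - (4 * L + m)) * q u) ≤ h * (q f + η) := by linarith
  exact le_of_mul_le_mul_left e5 h0

end Dissipativity

/-! ### The resolvent of the full operator by perturbation. -/

section Resolvent

variable {ε : ℝ} {C : Plane → Plane} {χ : Plane → ℝ} {M m : ℝ}

theorem isOperatorValue_iff (hC : Continuous C) (hM : ∀ x i, |C x i| ≤ M) (hχ : Continuous χ)
    (hm : ∀ x, |χ x| ≤ m) (u f : L1) :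
    IsOperatorValue ε C χ u f ↔ ∃ (a : L1) (g : Fin 2 → L1), IsHeatGenerator ε u a ∧
      (∀ i, IsWeakPartial i u (g i)) ∧ f = a - driftL C hC hM g + mulL χ hχ m hm u := by
  refine exists_congr fun a => exists_congr fun g => and_congr_right fun _ => and_congr_right
    fun _ => ?_
  have h : ∀ᵐ x, (a - driftL C hC hM g + mulL χ hχ m hm u : L1) x
      = a x - C x 0 * g 0 x - C x 1 * g 1 x + χ x * u x := by
    filter_upwards [Lp.coeFn_add (a - driftL C hC hM g) (mulL χ hχ m hm u),
      Lp.coeFn_sub a (driftL C hC hM g), coeFn_driftL hC hM g, coeFn_mulL hχ hm u]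
      with x h1 h2 h3 h4
    rw [h1, Pi.add_apply, h2, Pi.sub_apply, h3, h4, Fin.sum_univ_two]
    ring
  constructor
  · intro hf
    apply Lp.ext
    filter_upwards [hf, h] with x h1 h2
    rw [h1, h2]
  · rintro rfl
    exact h

/-- The operator `(χ - C·∇)(l - A)⁻¹`. -/
def pertL (ε : ℝ) (C : Plane → Plane) (hC : Continuous C) (hM : ∀ x i, |C x i| ≤ M)
    (χ : Plane → ℝ) (hχ : Continuous χ) (hm : ∀ x, |χ x| ≤ m) (l : ℝ) : L1 →L[ℝ] L1 :=
  mulL χ hχ m hm ∘L convB (resK ε l)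
    - ∑ i, mulL (fun x => C x i) (by fun_prop) M (fun x => hM x i) ∘L convB (gradResK ε i l)

theorem pertL_apply (hC : Continuous C) (hM : ∀ x i, |C x i| ≤ M) (hχ : Continuous χ)
    (hm : ∀ x, |χ x| ≤ m) (l : ℝ) (y : L1) :
    pertL ε C hC hM χ hχ hm l y = mulL χ hχ m hm (convB (resK ε l) y)
      - driftL C hC hM fun i => convB (gradResK ε i l) y := by
  simp [pertL, driftL]

theorem tendsto_norm_pertL (hε : 0 < ε) (hC : Continuous C) (hM : ∀ x i, |C x i| ≤ M)
    (hχ : Continuous χ) (hm : ∀ x, |χ x| ≤ m) :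
    Tendsto (fun l => ‖pertL ε C hC hM χ hχ hm l‖) atTop (𝓝 0) := by
  have hM0 : 0 ≤ M := (abs_nonneg _).trans (hM 0 0)
  have hm0 : 0 ≤ m := (abs_nonneg _).trans (hm 0)
  have h1 : Tendsto (fun l => m * ‖resK ε l‖ + M * ∑ i, ‖gradResK ε i l‖) atTop (𝓝 0) := by
    have := ((tendsto_norm_resK hε).const_mul m).add
      ((tendsto_finsetSum Finset.univ fun i _ => tendsto_norm_gradResK hε i).const_mul M)
    simpa using this
  refine squeeze_zero (fun l => norm_nonneg _) (fun l => ?_) h1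
  refine ContinuousLinearMap.opNorm_le_bound _ (by positivity) fun y => ?_
  rw [pertL_apply]
  have h2 := norm_driftL_sub_le hC hM (fun i => convB (gradResK ε i l) y) 0
  have h3 : driftL C hC hM 0 = 0 := by simp [driftL]
  rw [h3, sub_zero] at h2
  refine (norm_sub_le _ _).trans ?_
  rw [add_mul]
  refine add_le_add ((norm_mulL_le hχ hm _).trans ?_) (h2.trans ?_)
  · rw [mul_assoc]
    gcongr
    exact norm_convB_le _ _
  · rw [mul_assoc, Finset.sum_mul]
    gcongr with i
    simpa using norm_convB_le (gradResK ε i l) y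

/-- The resolvent `(l - (A - C·∇ + χ))⁻¹`. -/
def fullRes (ε : ℝ) (C : Plane → Plane) (hC : Continuous C) (hM : ∀ x i, |C x i| ≤ M)
    (χ : Plane → ℝ) (hχ : Continuous χ) (hm : ∀ x, |χ x| ≤ m) (l : ℝ) : L1 →L[ℝ] L1 :=
  convB (resK ε l) ∘L Ring.inverse (1 - pertL ε C hC hM χ hχ hm l)

theorem inverse_one_sub_apply {P : L1 →L[ℝ] L1} (hP : ‖P‖ < 1) (y : L1) :
    Ring.inverse (1 - P) (y - P y) = y ∧
      Ring.inverse (1 - P) y - P (Ring.inverse (1 - P) y) = y := by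
  have hu : IsUnit (1 - P) := isUnit_one_sub_of_norm_lt_one hP
  exact ⟨congrArg (fun A : L1 →L[ℝ] L1 => A y) (Ring.inverse_mul_cancel _ hu),
    congrArg (fun A : L1 →L[ℝ] L1 => A y) (Ring.mul_inverse_cancel _ hu)⟩

/-- Writing `u = (l - A)⁻¹ y`, the identity `(l - 𝒜)u = y - P y` reduces the resolvent equation to
inverting `1 - P`. Uniqueness of weak derivatives identifies any admissible gradient of `u` with the
one given by the kernel. -/
theorem isOperatorValue_iff_fullRes (hε : 0 < ε) (hC : Continuous C) (hM : ∀ x i, |C x i| ≤ M)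
    (hχ : Continuous χ) (hm : ∀ x, |χ x| ≤ m) {l : ℝ} (hl : 0 < l)
    (hP : ‖pertL ε C hC hM χ hχ hm l‖ < 1) (u f : L1) :
    IsOperatorValue ε C χ u f ↔ u = fullRes ε C hC hM χ hχ hm l (l • u - f) := by
  rw [isOperatorValue_iff hC hM hχ hm]
  constructor
  · rintro ⟨a, g, ha, hg, rfl⟩
    have hu := ha.eq_resK hε hl
    set y := l • u - a with hy
    have hgy : ∀ i, g i = convB (gradResK ε i l) y := fun i => by
      have h1 := isWeakPartial_resK hε i hl y
      rw [← hu] at h1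
      exact (hg i).unique h1
    have h2 : l • u - (a - driftL C hC hM g + mulL χ hχ m hm u)
        = y - pertL ε C hC hM χ hχ hm l y := by
      rw [pertL_apply, ← hu, ← funext hgy, hy]
      abel
    rw [h2, fullRes, ContinuousLinearMap.comp_apply, (inverse_one_sub_apply hP y).1]
    exact hu
  · intro hu
    set y := Ring.inverse (1 - pertL ε C hC hM χ hχ hm l) (l • u - f) with hy
    have hu' : u = convB (resK ε l) y := hu
    have h1 := (inverse_one_sub_apply hP (l • u - f)).2
    rw [← hy, pertL_apply, ← hu'] at h1
    refine ⟨l • u - y, fun i => convB (gradResK ε i l) y, ?_, fun i => ?_, ?_⟩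
    · have := isHeatGenerator_resK hε hl y
      rwa [← hu'] at this
    · have := isWeakPartial_resK hε i hl y
      rwa [← hu'] at this
    · have h2 : f = l • u - (l • u - f) := by abel
      rw [h2, ← h1]
      abel

variable {L : NNReal}

theorem exists_isResolventFamily (hε : 0 < ε) (hC : LipschitzWith L C) (hM : ∀ x, ‖C x‖ ≤ M)
    (hMi : ∀ x i, |C x i| ≤ M) (hχ : Continuous χ) (hm : ∀ x, |χ x| ≤ m) :
    ∃ (R : ℝ → L1 →L[ℝ] L1) (β l₀ : ℝ), IsResolventFamily (IsOperatorValue ε C χ) R β l₀ ∧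
      ∀ l, l₀ ≤ l → ∀ u, 0 ≤ u → 0 ≤ R l u := by
  have hm0 : 0 ≤ m := (abs_nonneg _).trans (hm 0)
  obtain ⟨l₁, hl₁⟩ := eventually_atTop.1 ((tendsto_norm_pertL hε hC.continuous hMi hχ hm).eventually
    (gt_mem_nhds (zero_lt_one' ℝ)))
  set β : ℝ := 4 * L + m with hβ
  have hβ0 : 0 ≤ β := by positivity
  -- Beyond `l₁` the perturbation has norm below `1`; the other term gives `l₀ > 0` and `2β ≤ l₀`.
  set l₀ := max l₁ (2 * β + 1) with hl₀
  have hge : ∀ l, l₀ ≤ l → l₁ ≤ l ∧ 2 * β + 1 ≤ l := fun l hl =>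
    ⟨(le_max_left _ _).trans hl, (le_max_right _ _).trans hl⟩
  set R := fullRes ε C hC.continuous hMi χ hχ hm with hR
  have hop : ∀ l, l₀ ≤ l → ∀ u f, IsOperatorValue ε C χ u f ↔ u = R l (l • u - f) := fun l hl =>
    isOperatorValue_iff_fullRes hε hC.continuous hMi hχ hm (by linarith [(hge l hl).2])
      (hl₁ l (hge l hl).1)
  have hdis : ∀ q, IsContractivityGauge q → ∀ l, l₀ ≤ l → ∀ x, (l - β) * q (R l x) ≤ q x := by
    intro q hq l hl x
    have h1 : IsOperatorValue ε C χ (R l x) (l • R l x - x) := by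
      rw [hop l hl]
      simp
    obtain ⟨a, g, ha, hg, hf⟩ := (isOperatorValue_iff hC.continuous hMi hχ hm _ _).1 h1
    exact hq.dissipative hε hC hM hMi hχ hm (by linarith [(hge l hl).2]) ha hg hf.symm
  refine ⟨R, β, l₀, ⟨hop, hdis _ isContractivityGauge_norm, ?_, hβ0, ?_, ?_⟩, ?_⟩
  · have hsurj : Function.Surjective
        (Ring.inverse (1 - pertL ε C hC.continuous hMi χ hχ hm l₀) : L1 →L[ℝ] L1) := fun y =>
      ⟨_, (inverse_one_sub_apply (hl₁ l₀ (hge l₀ le_rfl).1) y).1⟩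
    exact (denseRange_resK hε (by linarith [(hge l₀ le_rfl).2])).comp hsurj.denseRange
      (convB (resK ε l₀)).continuous
  · linarith [(hge l₀ le_rfl).2]
  · linarith [(hge l₀ le_rfl).2]
  · intro l hl u hu
    -- Dissipativity for `‖·⁻‖` reads `(l - β)‖(R l u)⁻‖ ≤ ‖u⁻‖ = 0`.
    have h1 := hdis _ isContractivityGauge_negPart l hl u
    rw [negPart_of_nonneg hu, norm_zero] at h1
    have h2 : 0 < l - β := by linarith [(hge l hl).2]
    have h3 : ‖(R l u)⁻‖ ≤ 0 := by nlinarith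
    exact negPart_eq_zero.1 (norm_le_zero_iff.1 h3)

end Resolvent

/-! ### Lipschitz bound for the velocity field and conclusion. -/

theorem IsAdmissibleField.exists_lipschitzWith {C : Plane → Plane} (hC : IsAdmissibleField C) :
    ∃ L : NNReal, LipschitzWith L C := by
  obtain ⟨M₀, h₀⟩ := hC.bounded_partial 0
  obtain ⟨M₁, h₁⟩ := hC.bounded_partial 1
  have hM₀ : 0 ≤ M₀ := (norm_nonneg _).trans (h₀ 0)
  have hM₁ : 0 ≤ M₁ := (norm_nonneg _).trans (h₁ 0)
  refine ⟨Real.toNNReal (M₀ + M₁), lipschitzWith_of_nnnorm_fderiv_le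
    (hC.contDiff.differentiable (by simp)) fun x => ?_⟩
  rw [← NNReal.coe_le_coe, coe_nnnorm, Real.coe_toNNReal _ (by positivity)]
  refine ContinuousLinearMap.opNorm_le_bound _ (by positivity) fun v => ?_
  have hv : v = v 0 • e 0 + v 1 • e 1 := by
    ext j
    fin_cases j <;> simp [e]
  have hn : ∀ i, ‖v i‖ ≤ ‖v‖ := fun i => PiLp.norm_apply_le v i
  calc ‖fderiv ℝ C x v‖ = ‖v 0 • fderiv ℝ C x (e 0) + v 1 • fderiv ℝ C x (e 1)‖ := by
        conv_lhs => rw [hv]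
        rw [map_add, map_smul, map_smul]
    _ ≤ ‖v‖ * M₀ + ‖v‖ * M₁ := by
        refine norm_add_le_of_le ?_ ?_
        · rw [norm_smul]
          exact mul_le_mul (hn 0) (h₀ x) (norm_nonneg _) (norm_nonneg _)
        · rw [norm_smul]
          exact mul_le_mul (hn 1) (h₁ x) (norm_nonneg _) (norm_nonneg _)
    _ = (M₀ + M₁) * ‖v‖ := by ring

end ConvDiff

end

theorem mainTheorem5 (ε : ℝ) (hε : 0 < ε)
    (C : ConvDiff.Plane → ConvDiff.Plane) (hC : ConvDiff.IsAdmissibleField C)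
    (χ : ConvDiff.Plane → ℝ) (hχb : ∃ M : ℝ, ∀ x, |χ x| ≤ M) (hχu : UniformContinuous χ) :
    ConvDiff.heatDomain ε ⊆ ConvDiff.W11 ∧
    ∀ v₀ : ConvDiff.L1, 0 ≤ v₀ →
      ∃ v : ℝ → ConvDiff.L1,
        ConvDiff.IsMildSolution ε C χ v₀ v ∧
        (∀ t, 0 ≤ t → 0 ≤ v t) ∧
        ∀ w : ℝ → ConvDiff.L1, ConvDiff.IsMildSolution ε C χ v₀ w →
          ∀ t, 0 ≤ t → w t = v t := by
  refine ⟨ConvDiff.heatDomain_subset_W11 hε, fun v₀ hv₀ => ?_⟩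
  obtain ⟨M, hM⟩ := hC.bounded
  obtain ⟨m, hm⟩ := hχb
  obtain ⟨L, hL⟩ := hC.exists_lipschitzWith
  have hMi : ∀ x i, |C x i| ≤ M := fun x i => (PiLp.norm_apply_le (C x) i).trans (hM x)
  obtain ⟨R, β, l₀, hR, hpos⟩ :=
    ConvDiff.exists_isResolventFamily hε hL hM hMi hχu.continuous hm
  obtain ⟨v, hvc, hvop, hvlim⟩ := hR.exists_mild v₀
  refine ⟨v, ⟨hvc, fun t ht => ⟨v t - v₀, hvop t ht, by abel⟩⟩, fun t ht => ?_,
    fun w hw t ht => ?_⟩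
  -- The nonnegative cone is closed and, for large `n`, preserved by the Yosida semigroups because
  -- the resolvents are positive.
  · refine ge_of_tendsto (hvlim t ht) ?_
    filter_upwards [(tendsto_natCast_atTop_atTop (R := ℝ)).eventually_ge_atTop l₀] with n hn
    refine ConvDiff.yosidaExp_mem (P := {u : ConvDiff.L1 | 0 ≤ u}) isClosed_Ici
      (le_refl (0 : ConvDiff.L1))
      (fun x (hx : 0 ≤ x) y (hy : 0 ≤ y) => (add_nonneg hx hy : 0 ≤ x + y))
      (fun r hr x hx => ?_) (fun x hx => hpos n hn x hx) ht hv₀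
    have hx' : 0 ≤ x := hx
    change 0 ≤ r • x
    rw [← Lp.coeFn_nonneg]
    filter_upwards [Lp.coeFn_smul r x, ConvDiff.coeFn_nonneg hx'] with y h1 h2
    rw [h1]
    exact mul_nonneg hr h2
  · refine hR.mild_unique hvc hw.1 hvop (fun s hs => ?_) ht
    obtain ⟨f, hf, hws⟩ := hw.2 s hs
    rw [hws, add_sub_cancel_left]
    exact hf
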